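/- Let $\mathscr C$ be a braided monoidal category with braiding $c$, equipped with a $*$-autonomous structure: an object $D$ such that $\mathscr C(-\otimes B,D)$ is represented by an object $SB$ (left internal hom) for every $B$, and the resulting functor $S:\mathscr C^{op}\to\mathscr C$ is an equivalence. Then $\mathscr C(A\otimes -,D)$ is also representable, by an object $S'A$. Write $e_B:SB\otimes B\to D$ and $e'_A:A\otimes S'A\to D$ for the evaluations; $e_{A,B}:S(A\otimes B)\otimes A\to SB$ and $e'_{A,B}:B\otimes S'(A\otimes B)\to S'A$ for the morphisms corresponding to $e_{A\otimes B}$ and $e'_{A\otimes B}$; $n_I:I\to SSI$ for the morphism corresponding to $1_{SI}$; and $\alpha_A:A\to SS'A$, $\beta_B:B\to S'SB$ for those corresponding to $e'_A$, $e_B$. Let $H$ be a Hopf algebra in $\mathscr C$, with multiplication $\mu$, unit $\eta$, comultiplication $\delta$, counit $\epsilon$ and invertible antipode $\sigma$. Let $T=H\otimes-$ be the monad with multiplication $\mu\otimes 1$ and unit $\eta\otimes 1$, with $\psi_{X,Y}=(1\otimes c_{H,X}\otimes 1)(\delta\otimes 1\otimes 1):T(X\otimes Y)\to TX\otimes TY$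 and $\psi_0=\epsilon:TI\to I$, and put $$\nu_X=\big(H\otimes S(H\otimes X)\xrightarrow{c}S(H\otimes X)\otimes H\xrightarrow{1\otimes\sigma}S(H\otimes X)\otimes H\xrightarrow{e_{H,X}}SX\big),$$ $$\nu'_X=\big(H\otimes S'(H\otimes X)\xrightarrow{\sigma^{-1}\otimes S'(c_{H,X}^{-1})}H\otimes S'(X\otimes H)\xrightarrow{e'_{X,H}}S'X\big).$$ (a) $T$ is a $*$-autonomous opmonoidal monad. That is, $T$ is an opmonoidal monad, $\nu:TST\to S$ and $\nu':TS'T\to S'$ are natural, and (writing $\mu,\eta$ also for the multiplication and unit of $T$): 1. $\nu\circ\eta_{ST}=S\eta$ and $\nu'\circ\eta_{S'T}=S'\eta$; 2. $\nu\circ\mu_{ST}=\nu\circ T\nu_T\circ TTS\mu$ and $\nu'\circ\mu_{S'T}=\nu'\circ T\nu'_T\circ TTS'\mu$; 3. for all $T$-algebras $A,B$ the morphism $e_{A,B}:S(A\otimes B)\otimes A\to SB$ is a morphism of $T$-algebras, where $SX$ has the action $\nu_X\circ TSa$ for a $T$-algebra $(X,a)$ and tensor products have the action obtained from $\psi$;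 4. $n_I\circ\psi_0=\nu_{SI}\circ TSTS\psi_0\circ TS\nu_I\circ Tn_I$; 5. $\alpha_T=\nu_{S'T}\circ TS\nu'\circ T\alpha$; 6. $\beta_T=\nu'_{ST}\circ TS'\nu\circ T\beta$. (b) $T$ has a right adjoint. Let $G=[H,-]$ be any right adjoint of $T$, with the comonad structure $(\delta,\epsilon)$ whose comultiplication and counit are the mates of the multiplication and unit of $T$, with the monoidal structure $\phi_{A,B}:GA\otimes GB\to G(A\otimes B)$, $\phi_0:I\to GI$ corresponding to $\psi,\psi_0$, and with the transformations $\nu:S\to GSG$, $\nu':S'\to GS'G$ corresponding to the above $\nu,\nu'$ under $T\dashv G$. Then $G$ is a $*$-autonomous monoidal comonad. That is, $G$ is a monoidal comonad, $\nu$ and $\nu'$ are natural, and 1. $\epsilon_{SG}\circ\nu=S\epsilon$ and $\epsilon_{S'G}\circ\nu'=S'\epsilon$; 2. $\delta_{SG}\circ\nu=GGS\delta\circ G\nu_G\circ\nu$ and $\delta_{S'G}\circ\nu'=GGS'\delta\circ G\nu'_G\circ\nu'$; 3. $\nu_B\circ e_{A,B}\circ(1\otimes\epsilon_A)=Ge_{GA,GB}\circ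 G(S\phi_{A,B}\otimes 1)\circ\phi_{SG(A\otimes B),GA}\circ(\nu_{A\otimes B}\otimes\delta_A):S(A\otimes B)\otimes GA\to GSGB$; 4. $Gn_I\circ\phi_0=GS\nu_I\circ GSGS\phi_0\circ\nu_{SI}\circ n_I$; 5. $G\alpha=GS\nu'\circ\nu_{S'G}\circ\alpha_G$; 6. $G\beta=GS'\nu\circ\nu'_{SG}\circ\beta_G$. (c) The monoidal category of left $H$-modules (with the diagonal action, via $\psi$, on tensor products) is $*$-autonomous. More precisely, it has a $*$-autonomous structure lifting that of $\mathscr C$: up to isomorphism, the dualizing module has underlying object $D$, and the left and right duals of a module $(X,a)$ are $SX$ with action $\nu_X\circ(H\otimes Sa)$ and $S'X$ with action $\nu'_X\circ(H\otimes S'a)$, with the evaluations of $\mathscr C$. -/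

import Mathlib

open CategoryTheory MonoidalCategory Opposite

universe v u

noncomputable section

section Raisers

variable {C : Type u} [Category.{v} C] [MonoidalCategory C]

/-- `D` is a *left raiser*: every `B` has a chosen left internal hom `hom B = [B, D]_l`, i.e. an
object representing `C(- ⊗ B, D)`. -/
structure LeftRaiser (D : C) where
  hom : C → C
  homEquiv (A B : C) : (A ⟶ hom B) ≃ (A ⊗ B ⟶ D)
  homEquiv_naturality {A A' : C} (g : A' ⟶ A) (B : C) (f : A ⟶ hom B) :
    homEquiv A' B (g ≫ f) = g ▷ B ≫ homEquiv A B f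

namespace LeftRaiser

variable {D : C} (L : LeftRaiser D)

/-- The evaluation `e_B : SB ⊗ B ⟶ D`. -/
def ev (B : C) : L.hom B ⊗ B ⟶ D := L.homEquiv (L.hom B) B (𝟙 _)

theorem homEquiv_eq {A B : C} (f : A ⟶ L.hom B) : L.homEquiv A B f = f ▷ B ≫ L.ev B := by
  have h := L.homEquiv_naturality f B (𝟙 _)
  rwa [Category.comp_id] at h

/-- The morphism `A ⟶ SB` corresponding to `A ⊗ B ⟶ D`. -/
def curry {A B : C} (g : A ⊗ B ⟶ D) : A ⟶ L.hom B := (L.homEquiv A B).symm g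

@[simp]
theorem curry_ev {A B : C} (g : A ⊗ B ⟶ D) : L.curry g ▷ B ≫ L.ev B = g := by
  rw [← homEquiv_eq, curry, Equiv.apply_symm_apply]

theorem hom_ext {A B : C} {f g : A ⟶ L.hom B} (h : f ▷ B ≫ L.ev B = g ▷ B ≫ L.ev B) : f = g := by
  rw [← homEquiv_eq, ← homEquiv_eq] at h
  exact (L.homEquiv A B).injective h

/-- The morphism `Sf : SB' ⟶ SB` for `f : B ⟶ B'`, determined by naturality of the evaluation. -/
def map {B B' : C} (f : B ⟶ B') : L.hom B' ⟶ L.hom B := L.curry (L.hom B' ◁ f ≫ L.ev B')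

theorem map_ev {B B' : C} (f : B ⟶ B') : L.map f ▷ B ≫ L.ev B = L.hom B' ◁ f ≫ L.ev B' :=
  L.curry_ev _

theorem map_id (B : C) : L.map (𝟙 B) = 𝟙 _ := L.hom_ext (by simp [map_ev])

theorem map_comp {X Y Z : C} (f : X ⟶ Y) (g : Y ⟶ Z) : L.map (f ≫ g) = L.map g ≫ L.map f :=
  L.hom_ext (by
    rw [map_ev, comp_whiskerRight, Category.assoc, map_ev, ← whisker_exchange_assoc, map_ev]
    simp)

theorem homEquiv_comp_map {A B B' : C} (k : A ⟶ L.hom B) (g : B' ⟶ B) :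
    L.homEquiv A B' (k ≫ L.map g) = A ◁ g ≫ L.homEquiv A B k := by
  rw [homEquiv_eq, homEquiv_eq, comp_whiskerRight, Category.assoc, map_ev, whisker_exchange_assoc]

/-- The functor `S = [-, D]_l : Cᵒᵖ ⥤ C`. -/
def dual : Cᵒᵖ ⥤ C where
  obj B := L.hom B.unop
  map f := L.map f.unop
  map_id B := L.map_id B.unop
  map_comp f g := L.map_comp g.unop f.unop

/-- The morphism `e_{B,C} : S(B ⊗ C) ⊗ B ⟶ SC` corresponding to `e_{B ⊗ C}`. -/
def evTensor (A B : C) : L.hom (A ⊗ B) ⊗ A ⟶ L.hom B :=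
  L.curry ((α_ _ _ _).hom ≫ L.ev (A ⊗ B))

/-- The morphism `n_I : I ⟶ SSI`, corresponding to `e_I : SI ⊗ I ⟶ D`, i.e. to the identity of
`SI`. -/
def unitDual : 𝟙_ C ⟶ L.hom (L.hom (𝟙_ C)) :=
  L.curry ((λ_ _).hom ≫ (ρ_ _).inv ≫ L.ev (𝟙_ C))

theorem evTensor_ev (A B : C) :
    L.evTensor A B ▷ B ≫ L.ev B = (α_ _ _ _).hom ≫ L.ev (A ⊗ B) :=
  L.curry_ev _

end LeftRaiser

/-- `D` is a *right raiser*: every `A` has a chosen right internal hom `hom A = [A, D]_r`, i.e. an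
object representing `C(A ⊗ -, D)`. -/
structure RightRaiser (D : C) where
  hom : C → C
  homEquiv (A B : C) : (B ⟶ hom A) ≃ (A ⊗ B ⟶ D)
  homEquiv_naturality (A : C) {B B' : C} (g : B' ⟶ B) (f : B ⟶ hom A) :
    homEquiv A B' (g ≫ f) = A ◁ g ≫ homEquiv A B f

namespace RightRaiser

variable {D : C} (R : RightRaiser D)

/-- The evaluation `e'_A : A ⊗ S'A ⟶ D`. -/
def ev (A : C) : A ⊗ R.hom A ⟶ D := R.homEquiv A (R.hom A) (𝟙 _)

theorem homEquiv_eq {A B : C} (f : B ⟶ R.hom A) : R.homEquiv A B f = A ◁ f ≫ R.ev A := by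
  have h := R.homEquiv_naturality A f (𝟙 _)
  rwa [Category.comp_id] at h

/-- The morphism `B ⟶ S'A` corresponding to `A ⊗ B ⟶ D`. -/
def curry {A B : C} (g : A ⊗ B ⟶ D) : B ⟶ R.hom A := (R.homEquiv A B).symm g

@[simp]
theorem curry_ev {A B : C} (g : A ⊗ B ⟶ D) : A ◁ R.curry g ≫ R.ev A = g := by
  rw [← homEquiv_eq, curry, Equiv.apply_symm_apply]

theorem hom_ext {A B : C} {f g : B ⟶ R.hom A} (h : A ◁ f ≫ R.ev A = A ◁ g ≫ R.ev A) : f = g := by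
  rw [← homEquiv_eq, ← homEquiv_eq] at h
  exact (R.homEquiv A B).injective h

/-- The morphism `S'f : S'A' ⟶ S'A` for `f : A ⟶ A'`, determined by naturality of the
evaluation. -/
def map {A A' : C} (f : A ⟶ A') : R.hom A' ⟶ R.hom A := R.curry (f ▷ R.hom A' ≫ R.ev A')

theorem map_ev {A A' : C} (f : A ⟶ A') : A ◁ R.map f ≫ R.ev A = f ▷ R.hom A' ≫ R.ev A' :=
  R.curry_ev _

/-- The morphism `e'_{A,B} : B ⊗ S'(A ⊗ B) ⟶ S'A` corresponding to `e'_{A ⊗ B}`. -/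
def evTensor (A B : C) : B ⊗ R.hom (A ⊗ B) ⟶ R.hom A :=
  R.curry ((α_ _ _ _).inv ≫ R.ev (A ⊗ B))

theorem evTensor_ev (A B : C) :
    A ◁ R.evTensor A B ≫ R.ev A = (α_ _ _ _).inv ≫ R.ev (A ⊗ B) :=
  R.curry_ev _

end RightRaiser

/-- The unit `α_A : A ⟶ SS'A` of the contravariant adjunction between `S` and `S'`. -/
def raiserUnit {D : C} (L : LeftRaiser D) (R : RightRaiser D) (A : C) :
    A ⟶ L.hom (R.hom A) := L.curry (R.ev A)

/-- The counit `β_B : B ⟶ S'SB` of the contravariant adjunction between `S` and `S'`. -/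
def raiserCounit {D : C} (L : LeftRaiser D) (R : RightRaiser D) (B : C) :
    B ⟶ R.hom (L.hom B) := R.curry (L.ev B)

/-- A `*`-autonomous structure: a dualizing object `D`, i.e. a left raiser for which `S` is an
equivalence. Such a `D` is automatically a right raiser (see `StarAutonomous.ofLeftRaiser`); the
structure includes a choice of right internal homs into `D`. -/
structure StarAutonomous (C : Type u) [Category.{v} C] [MonoidalCategory C] where
  D : C
  left : LeftRaiser D
  right : RightRaiser D
  isEquivalence : left.dual.IsEquivalence

/-- A left raiser `D` with `S` an equivalence is a right raiser, so defines a `*`-autonomous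
structure. -/
def StarAutonomous.ofLeftRaiser {D : C} (L : LeftRaiser D) [L.dual.IsEquivalence] :
    StarAutonomous C where
  D := D
  left := L
  right :=
    { hom := fun A => (L.dual.inv.obj A).unop
      homEquiv := fun A B =>
        (opEquiv (L.dual.inv.obj A) (op B)).symm.trans
          ((L.dual.asEquivalence.symm.toAdjunction.homEquiv A (op B)).trans (L.homEquiv A B))
      homEquiv_naturality := by
        intro A B B' g f
        have h := L.dual.asEquivalence.symm.toAdjunction.homEquiv_naturality_right f.op g.op
        have h2 := congrArg (L.homEquiv A B') h
        refine h2.trans ?_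
        exact L.homEquiv_comp_map _ g }
  isEquivalence := inferInstance

end Raisers

section Comonads

variable {C : Type u} [Category.{v} C] [MonoidalCategory C]

open Functor.LaxMonoidal in
/-- `ν : S ⟶ GSG` and `ν' : S' ⟶ GS'G` make the comonad `G` on `C`, whose underlying functor is lax
monoidal, into a `*`-autonomous monoidal comonad. -/
structure IsStarAutonomousComonad (G : Comonad C) [G.toFunctor.LaxMonoidal] {D : C}
    (L : LeftRaiser D) (R : RightRaiser D)
    (ν : ∀ X, L.hom X ⟶ G.obj (L.hom (G.obj X)))
    (ν' : ∀ X, R.hom X ⟶ G.obj (R.hom (G.obj X))) : Prop where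
  monoidal_ε : NatTrans.IsMonoidal G.ε
  monoidal_δ : NatTrans.IsMonoidal G.δ
  naturality {X Y : C} (f : X ⟶ Y) :
    L.map f ≫ ν X = ν Y ≫ G.map (L.map (G.map f))
  naturality' {X Y : C} (f : X ⟶ Y) :
    R.map f ≫ ν' X = ν' Y ≫ G.map (R.map (G.map f))
  counit (X : C) : ν X ≫ G.ε.app (L.hom (G.obj X)) = L.map (G.ε.app X)
  counit' (X : C) : ν' X ≫ G.ε.app (R.hom (G.obj X)) = R.map (G.ε.app X)
  comul (X : C) : ν X ≫ G.δ.app (L.hom (G.obj X)) =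
    ν X ≫ G.map (ν (G.obj X)) ≫ G.map (G.map (L.map (G.δ.app X)))
  comul' (X : C) : ν' X ≫ G.δ.app (R.hom (G.obj X)) =
    ν' X ≫ G.map (ν' (G.obj X)) ≫ G.map (G.map (R.map (G.δ.app X)))
  evTensor (A B : C) :
    L.hom (A ⊗ B) ◁ G.ε.app A ≫ L.evTensor A B ≫ ν B =
      (ν (A ⊗ B) ⊗ₘ G.δ.app A) ≫ μ G.toFunctor (L.hom (G.obj (A ⊗ B))) (G.obj A) ≫
        G.map (L.map (μ G.toFunctor A B) ▷ G.obj A) ≫ G.map (L.evTensor (G.obj A) (G.obj B))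
  unitDual :
    ε G.toFunctor ≫ G.map L.unitDual =
      L.unitDual ≫ ν (L.hom (𝟙_ C)) ≫
        G.map (L.map (G.map (L.map (ε G.toFunctor)))) ≫ G.map (L.map (ν (𝟙_ C)))
  unit (X : C) :
    G.map (raiserUnit L R X) =
      raiserUnit L R (G.obj X) ≫ ν (R.hom (G.obj X)) ≫ G.map (L.map (ν' X))
  counitDual (X : C) :
    G.map (raiserCounit L R X) =
      raiserCounit L R (G.obj X) ≫ ν' (L.hom (G.obj X)) ≫ G.map (R.map (ν X))

open Functor.OplaxMonoidal in
/-- The monad `T`, whose underlying functor is oplax monoidal, is an opmonoidal monad: its unit and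
multiplication are opmonoidal transformations. -/
structure IsOpmonoidalMonad (T : Monad C) [T.toFunctor.OplaxMonoidal] : Prop where
  η_unit : T.η.app (𝟙_ C) ≫ η T.toFunctor = 𝟙 _
  η_tensor (X Y : C) : T.η.app (X ⊗ Y) ≫ δ T.toFunctor X Y = (T.η.app X ⊗ₘ T.η.app Y)
  μ_unit : T.μ.app (𝟙_ C) ≫ η T.toFunctor = T.map (η T.toFunctor) ≫ η T.toFunctor
  μ_tensor (X Y : C) : T.μ.app (X ⊗ Y) ≫ δ T.toFunctor X Y =
    T.map (δ T.toFunctor X Y) ≫ δ T.toFunctor (T.obj X) (T.obj Y) ≫ (T.μ.app X ⊗ₘ T.μ.app Y)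

open Functor.OplaxMonoidal in
/-- `ν : TST ⟶ S` and `ν' : TS'T ⟶ S'` make `T` into a `*`-autonomous opmonoidal monad. -/
structure IsStarAutonomousMonad (T : Monad C) [T.toFunctor.OplaxMonoidal] {D : C}
    (L : LeftRaiser D) (R : RightRaiser D)
    (ν : ∀ X, T.obj (L.hom (T.obj X)) ⟶ L.hom X)
    (ν' : ∀ X, T.obj (R.hom (T.obj X)) ⟶ R.hom X) : Prop where
  isOpmonoidalMonad : IsOpmonoidalMonad T
  naturality {X Y : C} (f : X ⟶ Y) :
    T.map (L.map (T.map f)) ≫ ν X = ν Y ≫ L.map f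
  naturality' {X Y : C} (f : X ⟶ Y) :
    T.map (R.map (T.map f)) ≫ ν' X = ν' Y ≫ R.map f
  unit (X : C) : T.η.app (L.hom (T.obj X)) ≫ ν X = L.map (T.η.app X)
  unit' (X : C) : T.η.app (R.hom (T.obj X)) ≫ ν' X = R.map (T.η.app X)
  mul (X : C) : T.μ.app (L.hom (T.obj X)) ≫ ν X =
    T.map (T.map (L.map (T.μ.app X))) ≫ T.map (ν (T.obj X)) ≫ ν X
  mul' (X : C) : T.μ.app (R.hom (T.obj X)) ≫ ν' X =
    T.map (T.map (R.map (T.μ.app X))) ≫ T.map (ν' (T.obj X)) ≫ ν' X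
  /-- For `T`-algebras `A` and `B`, the morphism `e_{A,B} : S(A ⊗ B) ⊗ A ⟶ SB` is a morphism of
  `T`-algebras, where `S` of an algebra `(X, a)` has the action `Sa` followed by `ν`. -/
  evTensor (A B : T.Algebra) :
    T.map (L.evTensor A.A B.A) ≫ T.map (L.map B.a) ≫ ν B.A =
      δ T.toFunctor (L.hom (A.A ⊗ B.A)) A.A ≫
        ((T.map (L.map (δ T.toFunctor A.A B.A ≫ (A.a ⊗ₘ B.a))) ≫ ν (A.A ⊗ B.A)) ⊗ₘ A.a) ≫
          L.evTensor A.A B.A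
  unitDual :
    η T.toFunctor ≫ L.unitDual =
      T.map L.unitDual ≫ T.map (L.map (ν (𝟙_ C))) ≫
        T.map (L.map (T.map (L.map (η T.toFunctor)))) ≫ ν (L.hom (𝟙_ C))
  dualUnit (X : C) :
    raiserUnit L R (T.obj X) =
      T.map (raiserUnit L R X) ≫ T.map (L.map (ν' X)) ≫ ν (R.hom (T.obj X))
  dualCounit (X : C) :
    raiserCounit L R (T.obj X) =
      T.map (raiserCounit L R X) ≫ T.map (R.map (ν X)) ≫ ν' (L.hom (T.obj X))

end Comonads

section Mates

variable {C : Type u} [Category.{v} C]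

/-- The action `TGX ⟶ GX` whose transpose is the comultiplication of `mateComonad` at `X`. -/
def mateAction (T : Monad C) {G : C ⥤ C} (adj : T.toFunctor ⊣ G) (X : C) :
    T.obj (G.obj X) ⟶ G.obj X :=
  adj.unit.app _ ≫ G.map (T.μ.app (G.obj X) ≫ adj.counit.app X)

theorem map_mateAction (T : Monad C) {G : C ⥤ C} (adj : T.toFunctor ⊣ G) (X : C) :
    T.map (mateAction T adj X) ≫ adj.counit.app X = T.μ.app (G.obj X) ≫ adj.counit.app X := by
  simp [mateAction]

theorem mu_mateAction (T : Monad C) {G : C ⥤ C} (adj : T.toFunctor ⊣ G) (X : C) :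
    T.μ.app (G.obj X) ≫ mateAction T adj X =
      T.map (mateAction T adj X) ≫ mateAction T adj X := by
  apply (adj.homEquiv _ _).symm.injective
  rw [adj.homEquiv_counit, adj.homEquiv_counit, Functor.map_comp, Functor.map_comp,
    Category.assoc, Category.assoc, map_mateAction, T.mu_naturality_assoc, map_mateAction,
    ← Category.assoc, ← Category.assoc, T.assoc]

theorem eta_mateAction (T : Monad C) {G : C ⥤ C} (adj : T.toFunctor ⊣ G) (X : C) :
    T.η.app (G.obj X) ≫ mateAction T adj X = 𝟙 _ := by
  apply (adj.homEquiv _ _).symm.injective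
  have h : T.map (T.η.app (G.obj X)) ≫ T.μ.app (G.obj X) ≫ adj.counit.app X =
      T.map (𝟙 (G.obj X)) ≫ adj.counit.app X := by
    rw [← Category.assoc, T.right_unit]
    exact congrArg (fun k => k ≫ adj.counit.app X) (T.map_id (G.obj X)).symm
  rw [adj.homEquiv_counit, adj.homEquiv_counit, Functor.map_comp, Category.assoc, map_mateAction]
  exact h

/-- The comultiplication of `mateComonad`. -/
def mateComul (T : Monad C) {G : C ⥤ C} (adj : T.toFunctor ⊣ G) (X : C) :
    G.obj X ⟶ G.obj (G.obj X) :=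
  adj.unit.app (G.obj X) ≫ G.map (mateAction T adj X)

theorem map_mateComul (T : Monad C) {G : C ⥤ C} (adj : T.toFunctor ⊣ G) (X : C) :
    T.map (mateComul T adj X) ≫ adj.counit.app (G.obj X) = mateAction T adj X := by
  simp [mateComul]

theorem mateAction_mateComul (T : Monad C) {G : C ⥤ C} (adj : T.toFunctor ⊣ G) (X : C) :
    mateAction T adj X ≫ mateComul T adj X =
      T.map (mateComul T adj X) ≫ mateAction T adj (G.obj X) := by
  apply (adj.homEquiv _ _).symm.injective
  rw [adj.homEquiv_counit, adj.homEquiv_counit, Functor.map_comp, Functor.map_comp,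
    Category.assoc, Category.assoc, map_mateAction, T.mu_naturality_assoc, map_mateComul,
    mu_mateAction]

/-- The comonad structure carried by a right adjoint `G` of a monad `T`: the counit and
comultiplication are the mates of the unit and multiplication of `T`. -/
def mateComonad (T : Monad C) {G : C ⥤ C} (adj : T.toFunctor ⊣ G) : Comonad C :=
  have hδ (X : C) : (conjugateEquiv adj (adj.comp adj) T.μ).app X = mateComul T adj X := by
    simp [mateComul, mateAction]
  have hε (X : C) : (conjugateEquiv adj Adjunction.id T.η).app X =
      T.η.app (G.obj X) ≫ adj.counit.app X := by
    simp
  { toFunctor := G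
    ε := conjugateEquiv adj Adjunction.id T.η
    δ := conjugateEquiv adj (adj.comp adj) T.μ
    coassoc := fun X => by
      have h : mateComul T adj X ≫ G.map (mateComul T adj X) =
          mateComul T adj X ≫ mateComul T adj (G.obj X) := by
        have h1 : mateComul T adj X ≫ G.map (mateComul T adj X) =
            adj.unit.app (G.obj X) ≫ G.map (mateAction T adj X ≫ mateComul T adj X) := by
          rw [Functor.map_comp, ← Category.assoc]
          rfl
        have h2 : mateComul T adj X ≫ mateComul T adj (G.obj X) = adj.unit.app (G.obj X) ≫
            G.map (T.map (mateComul T adj X) ≫ mateAction T adj (G.obj X)) := by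
          rw [Functor.map_comp]
          exact (adj.unit_naturality_assoc (mateComul T adj X) _).symm
        rw [h1, h2, mateAction_mateComul]
      rw [hδ X]
      exact h.trans (congrArg (fun k => mateComul T adj X ≫ k) (hδ (G.obj X)).symm)
    left_counit := fun X => by
      have h : mateComul T adj X ≫ T.η.app (G.obj (G.obj X)) ≫ adj.counit.app (G.obj X) =
          𝟙 (G.obj X) := by
        refine Eq.trans ?_ (eta_mateAction T adj X)
        rw [← map_mateComul T adj X, T.unit_naturality_assoc]
      rw [hδ X]
      exact (congrArg (fun k => mateComul T adj X ≫ k) (hε (G.obj X))).trans h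
    right_counit := fun X => by
      have h : mateAction T adj X ≫ T.η.app (G.obj X) ≫ adj.counit.app X = adj.counit.app X := by
        have h1 : mateAction T adj X ≫ T.η.app (G.obj X) ≫ adj.counit.app X =
            T.η.app (T.obj (G.obj X)) ≫ T.map (mateAction T adj X) ≫ adj.counit.app X :=
          CategoryTheory.Monad.unit_naturality_assoc C T (mateAction T adj X) (adj.counit.app X)
        have h2 : T.η.app (T.obj (G.obj X)) ≫ T.μ.app (G.obj X) ≫ adj.counit.app X =
            adj.counit.app X := by
          rw [← Category.assoc, T.left_unit]
          exact Category.id_comp _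
        rw [map_mateAction] at h1
        exact h1.trans h2
      have h3 : mateComul T adj X ≫ G.map (T.η.app (G.obj X) ≫ adj.counit.app X) =
          𝟙 (G.obj X) := by
        rw [mateComul, Category.assoc, ← Functor.map_comp, h]
        simp
      rw [hδ X, hε X]
      exact h3 }

/-- The transformation `S ⟶ GSG` corresponding under `T ⊣ G` to `ν : TST ⟶ S`. -/
def LeftRaiser.mate [MonoidalCategory C] {D : C} (L : LeftRaiser D) (T : Monad C) {G : C ⥤ C}
    (adj : T.toFunctor ⊣ G) (ν : ∀ X, T.obj (L.hom (T.obj X)) ⟶ L.hom X) (X : C) :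
    L.hom X ⟶ G.obj (L.hom (G.obj X)) :=
  adj.homEquiv _ _ (T.map (L.map (adj.counit.app X)) ≫ ν (G.obj X))

/-- The transformation `S' ⟶ GS'G` corresponding under `T ⊣ G` to `ν' : TS'T ⟶ S'`. -/
def RightRaiser.mate [MonoidalCategory C] {D : C} (R : RightRaiser D) (T : Monad C) {G : C ⥤ C}
    (adj : T.toFunctor ⊣ G) (ν' : ∀ X, T.obj (R.hom (T.obj X)) ⟶ R.hom X) (X : C) :
    R.hom X ⟶ G.obj (R.hom (G.obj X)) :=
  adj.homEquiv _ _ (T.map (R.map (adj.counit.app X)) ≫ ν' (G.obj X))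

/-- The lax monoidal structure of the right adjoint of an opmonoidal monad. -/
instance [MonoidalCategory C] (T : Monad C) [T.toFunctor.OplaxMonoidal] {G : C ⥤ C}
    (adj : T.toFunctor ⊣ G) : (mateComonad T adj).toFunctor.LaxMonoidal :=
  adj.rightAdjointLaxMonoidal

end Mates

section Hopf

variable {C : Type u} [Category.{v} C] [MonoidalCategory C]

/-- The monad `T = H ⊗ -` of a monoid `H`. -/
def tensorMonad (H : C) [MonObj H] : Monad C where
  toFunctor := tensorLeft H
  η := { app := fun X => (λ_ X).inv ≫ MonObj.one ▷ X
         naturality := fun X Y f => by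
           change f ≫ (λ_ Y).inv ≫ MonObj.one ▷ Y = ((λ_ X).inv ≫ MonObj.one ▷ X) ≫ H ◁ f
           rw [leftUnitor_inv_naturality_assoc, whisker_exchange, Category.assoc] }
  μ := { app := fun X => (α_ H H X).inv ≫ MonObj.mul ▷ X
         naturality := fun X Y f => by
           change H ◁ H ◁ f ≫ (α_ H H Y).inv ≫ MonObj.mul ▷ Y =
             ((α_ H H X).inv ≫ MonObj.mul ▷ X) ≫ H ◁ f
           rw [associator_inv_naturality_right_assoc, whisker_exchange, Category.assoc] }
  assoc X := by
    change H ◁ ((α_ H H X).inv ≫ MonObj.mul ▷ X) ≫ (α_ H H X).inv ≫ MonObj.mul ▷ X =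
      ((α_ H H (H ⊗ X)).inv ≫ MonObj.mul ▷ (H ⊗ X)) ≫ (α_ H H X).inv ≫ MonObj.mul ▷ X
    have h := congrArg (fun f => (α_ H H (H ⊗ X)).inv ≫ (α_ (H ⊗ H) H X).inv ≫ f ▷ X)
      (MonObj.mul_assoc H)
    simp only [comp_whiskerRight] at h
    have h1 : (MonObj.mul (X := H) ▷ (H ⊗ X)) ≫ (α_ H H X).inv =
        (α_ (H ⊗ H) H X).inv ≫ MonObj.mul ▷ H ▷ X := by simp
    rw [Category.assoc, reassoc_of% h1, h]
    simp
  left_unit X := by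
    change ((λ_ (H ⊗ X)).inv ≫ MonObj.one ▷ (H ⊗ X)) ≫ (α_ H H X).inv ≫ MonObj.mul ▷ X = 𝟙 _
    have h1 : (MonObj.one (X := H) ▷ (H ⊗ X)) ≫ (α_ H H X).inv =
        (α_ _ H X).inv ≫ MonObj.one ▷ H ▷ X := by simp
    rw [Category.assoc, reassoc_of% h1, ← comp_whiskerRight, MonObj.one_mul]
    simp
  right_unit X := by
    change H ◁ ((λ_ X).inv ≫ MonObj.one ▷ X) ≫ (α_ H H X).inv ≫ MonObj.mul ▷ X = 𝟙 _
    have h1 : H ◁ (MonObj.one (X := H) ▷ X) ≫ (α_ H H X).inv =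
        (α_ H _ X).inv ≫ (H ◁ MonObj.one) ▷ X := by simp
    rw [MonoidalCategory.whiskerLeft_comp, Category.assoc, reassoc_of% h1, ← comp_whiskerRight,
      MonObj.mul_one]
    simp

variable [BraidedCategory C]

/-- The morphism `H ⊗ (X ⊗ Y) ⟶ (H ⊗ X) ⊗ (H ⊗ Y)`: the comultiplication of `H` followed by the
braiding `c_{H,X}`. -/
def tensorComul (H : C) [ComonObj H] (X Y : C) : H ⊗ (X ⊗ Y) ⟶ (H ⊗ X) ⊗ (H ⊗ Y) :=
  ComonObj.comul ▷ (X ⊗ Y) ≫ tensorμ H H X Y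

/-- The morphism `H ⊗ I ⟶ I` given by the counit of `H`. -/
def tensorCounit (H : C) [ComonObj H] : H ⊗ 𝟙_ C ⟶ 𝟙_ C := (ρ_ H).hom ≫ ComonObj.counit

theorem tensorComul_natural (H : C) [ComonObj H] {X X' Y Y' : C} (f : X ⟶ X') (g : Y ⟶ Y') :
    tensorComul H X Y ≫ (H ◁ f ⊗ₘ H ◁ g) = H ◁ (f ⊗ₘ g) ≫ tensorComul H X' Y' := by
  rw [tensorComul, tensorComul, Category.assoc, ← tensorμ_natural_right, whisker_exchange_assoc]

theorem tensorComul_assoc (H : C) [ComonObj H] (X Y Z : C) :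
    tensorComul H (X ⊗ Y) Z ≫ tensorComul H X Y ▷ (H ⊗ Z) ≫
        (α_ (H ⊗ X) (H ⊗ Y) (H ⊗ Z)).hom =
      H ◁ (α_ X Y Z).hom ≫ tensorComul H X (Y ⊗ Z) ≫ (H ⊗ X) ◁ tensorComul H Y Z := by
  have h1 := tensorμ_natural (ComonObj.comul (X := H)) (𝟙 H) (𝟙 (X ⊗ Y)) (𝟙 Z)
  have h2 := tensorμ_natural (𝟙 H) (ComonObj.comul (X := H)) (𝟙 X) (𝟙 (Y ⊗ Z))
  have h3 := associator_monoidal H H H X Y Z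
  simp only [tensorHom_id, id_tensorHom, id_whiskerRight] at h1 h2
  simp only [tensorComul, comp_whiskerRight, MonoidalCategory.whiskerLeft_comp, Category.assoc]
  rw [← reassoc_of% h1, h3, ← reassoc_of% h2, tensorHom_def_assoc, ← comp_whiskerRight_assoc,
    ← comp_whiskerRight_assoc, whisker_exchange_assoc, whisker_exchange_assoc,
    ← comp_whiskerRight_assoc, Category.assoc, ← ComonObj.comul_assoc]

theorem tensorComul_counit_left (H : C) [ComonObj H] (X : C) :
    (λ_ (H ⊗ X)).inv =
      H ◁ (λ_ X).inv ≫ tensorComul H (𝟙_ C) X ≫ tensorCounit H ▷ (H ⊗ X) := by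
  have h1 := tensorμ_natural (ComonObj.counit (X := H)) (𝟙 H) (𝟙 (𝟙_ C)) (𝟙 X)
  have h2 := leftUnitor_monoidal H X
  simp only [tensorHom_id, id_whiskerRight] at h1
  have h3 : (ρ_ H).hom ≫ ComonObj.counit = ComonObj.counit ▷ 𝟙_ C ≫ (λ_ (𝟙_ C)).hom := by
    rw [← unitors_equal.symm, rightUnitor_naturality]
  rw [tensorComul, tensorCounit, h3, comp_whiskerRight, Category.assoc, ← reassoc_of% h1,
    ← comp_whiskerRight_assoc, ComonObj.counit_comul, ← cancel_mono (λ_ (H ⊗ X)).hom]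
  simp only [Category.assoc, Iso.inv_hom_id]
  rw [← h2]
  simp [MonoidalCategory.tensorHom_def]

theorem tensorComul_counit_right (H : C) [ComonObj H] (X : C) :
    (ρ_ (H ⊗ X)).inv =
      H ◁ (ρ_ X).inv ≫ tensorComul H X (𝟙_ C) ≫ (H ⊗ X) ◁ tensorCounit H := by
  have h1 := tensorμ_natural (𝟙 H) (ComonObj.counit (X := H)) (𝟙 X) (𝟙 (𝟙_ C))
  have h2 := rightUnitor_monoidal H X
  simp only [tensorHom_id, id_tensorHom, id_whiskerRight] at h1
  have h3 : (ρ_ H).hom ≫ ComonObj.counit = ComonObj.counit ▷ 𝟙_ C ≫ (λ_ (𝟙_ C)).hom := by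
    rw [← unitors_equal.symm, rightUnitor_naturality]
  rw [tensorComul, tensorCounit, h3, MonoidalCategory.whiskerLeft_comp, Category.assoc,
    ← reassoc_of% h1,
    ← comp_whiskerRight_assoc, ComonObj.comul_counit, ← cancel_mono (ρ_ (H ⊗ X)).hom]
  simp only [Category.assoc, Iso.inv_hom_id]
  rw [← h2]
  simp [MonoidalCategory.tensorHom_def]

/-- The opmonoidal structure of `T = H ⊗ -` for a bimonoid `H`. -/
instance (H : C) [BimonObj H] : (tensorMonad H).toFunctor.OplaxMonoidal where
  η := tensorCounit H
  δ X Y := tensorComul H X Y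
  δ_natural_left f X := by
    have h := tensorComul_natural H f (𝟙 X)
    rw [whiskerLeft_id, tensorHom_id, tensorHom_id] at h
    exact h
  δ_natural_right X f := by
    have h := tensorComul_natural H (𝟙 X) f
    rw [whiskerLeft_id, id_tensorHom, id_tensorHom] at h
    exact h
  oplax_associativity X Y Z := tensorComul_assoc H X Y Z
  oplax_left_unitality X := tensorComul_counit_left H X
  oplax_right_unitality X := tensorComul_counit_right H X

theorem mul_tensorComul (H : C) [BimonObj H] (X Y : C) :
    ((α_ H H (X ⊗ Y)).inv ≫ MonObj.mul ▷ (X ⊗ Y)) ≫ tensorComul H X Y =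
      H ◁ tensorComul H X Y ≫ tensorComul H (H ⊗ X) (H ⊗ Y) ≫
        (((α_ H H X).inv ≫ MonObj.mul ▷ X) ⊗ₘ ((α_ H H Y).inv ≫ MonObj.mul ▷ Y)) := by
  have h1 := tensor_associativity H H H H X Y
  have h2 : tensorμ H H H H ▷ (X ⊗ Y) ≫ tensorμ (H ⊗ H) (H ⊗ H) X Y =
      (α_ (H ⊗ H) (H ⊗ H) (X ⊗ Y)).hom ≫ (H ⊗ H) ◁ tensorμ H H X Y ≫
        tensorμ H H (H ⊗ X) (H ⊗ Y) ≫ ((α_ H H X).inv ⊗ₘ (α_ H H Y).inv) := by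
    rw [← reassoc_of% h1, tensorHom_comp_tensorHom, Iso.hom_inv_id, Iso.hom_inv_id]
    simp
  simp only [tensorComul, Category.assoc]
  rw [← comp_whiskerRight_assoc, BimonObj.mul_comul,
    comp_whiskerRight, comp_whiskerRight]
  simp only [Category.assoc]
  rw [tensorμ_natural_left, reassoc_of% h2, tensorHom_comp_tensorHom,
    MonoidalCategory.whiskerLeft_comp, MonoidalCategory.tensorHom_def (ComonObj.comul (X := H))]
  simp only [Category.assoc, comp_whiskerRight]
  rw [associator_naturality_middle_assoc, whisker_exchange_assoc, whisker_exchange_assoc]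
  simp

theorem one_tensorComul (H : C) [BimonObj H] (X Y : C) :
    ((λ_ (X ⊗ Y)).inv ≫ MonObj.one ▷ (X ⊗ Y)) ≫ tensorComul H X Y =
      (((λ_ X).inv ≫ MonObj.one ▷ X) ⊗ₘ ((λ_ Y).inv ≫ MonObj.one ▷ Y)) := by
  have h := tensor_left_unitality X Y
  rw [tensorComul, Category.assoc, ← comp_whiskerRight_assoc, Bimon.one_comul, comp_whiskerRight,
    Category.assoc, tensorμ_natural_left, Iso.inv_comp_eq, ← tensorHom_comp_tensorHom, h]
  simp only [Category.assoc]
  rw [tensorHom_comp_tensorHom_assoc, Iso.hom_inv_id, Iso.hom_inv_id]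
  simp

theorem mul_tensorCounit (H : C) [BimonObj H] :
    ((α_ H H (𝟙_ C)).inv ≫ MonObj.mul ▷ (𝟙_ C)) ≫ tensorCounit H =
      H ◁ tensorCounit H ≫ tensorCounit H := by
  rw [tensorCounit, Category.assoc, rightUnitor_naturality_assoc, Bimon.mul_counit]
  have h := rightUnitor_naturality (ComonObj.counit (X := H))
  rw [MonoidalCategory.tensorHom_def', unitors_equal, Category.assoc, h]
  simp

theorem one_tensorCounit (H : C) [BimonObj H] :
    ((λ_ (𝟙_ C)).inv ≫ MonObj.one ▷ (𝟙_ C)) ≫ tensorCounit H = 𝟙 _ := by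
  rw [tensorCounit, Category.assoc, rightUnitor_naturality_assoc, BimonObj.one_counit,
    ← unitors_equal]
  simp

/-! ### The monoidal category of modules over a bimonoid -/

/-- `H` acts on `X ⊗ Y` diagonally through its comultiplication. -/
@[reducible]
def tensorModObj (H : C) [BimonObj H] (X Y : C) [ModObj H X] [ModObj H Y] : ModObj H (X ⊗ Y) where
  smul := tensorComul H X Y ≫ (ModObj.smul (M := H) (X := X) ⊗ₘ ModObj.smul (M := H) (X := Y))
  one_smul := by
    change MonObj.one ▷ (X ⊗ Y) ≫ tensorComul H X Y ≫ _ = (λ_ (X ⊗ Y)).hom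
    have h := one_tensorComul H X Y
    rw [Category.assoc, Iso.inv_comp_eq] at h
    rw [reassoc_of% h, tensorHom_comp_tensorHom, Category.assoc, Category.assoc,
      ModObj.one_smul_self, ModObj.one_smul_self]
    simp
  mul_smul := by
    change MonObj.mul ▷ (X ⊗ Y) ≫ tensorComul H X Y ≫ _ = (α_ H H (X ⊗ Y)).hom ≫
      H ◁ (tensorComul H X Y ≫ _) ≫ tensorComul H X Y ≫ _
    have h := mul_tensorComul H X Y
    rw [Category.assoc, Iso.inv_comp_eq] at h
    have h2 := tensorComul_natural H (ModObj.smul (M := H) (X := X)) (ModObj.smul (M := H) (X := Y))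
    rw [reassoc_of% h, MonoidalCategory.whiskerLeft_comp, Category.assoc, ← reassoc_of% h2,
      tensorHom_comp_tensorHom, tensorHom_comp_tensorHom, Category.assoc, Category.assoc,
      ModObj.mul_smul_self, ModObj.mul_smul_self, Iso.inv_hom_id_assoc, Iso.inv_hom_id_assoc]
    rfl

/-- `H` acts on the unit object through its counit. -/
@[reducible]
def unitModObj (H : C) [BimonObj H] : ModObj H (𝟙_ C) where
  smul := tensorCounit H
  one_smul := by
    have h := one_tensorCounit H
    rw [Category.assoc, Iso.inv_comp_eq] at h
    exact h.trans (Category.comp_id _)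
  mul_smul := by
    have h := mul_tensorCounit H
    rw [Category.assoc, Iso.inv_comp_eq] at h
    exact h

end Hopf

section Modules

variable {C : Type u} [Category.{v} C] [MonoidalCategory C]

/-- The action `H ⊗ M ⟶ M` on an `H`-module `M`. -/
def moduleAction {H : C} [MonObj H] (M : Mod C H) : H ⊗ M.X ⟶ M.X := ModObj.smul (M := H) (X := M.X)

theorem moduleAction_hom {H : C} [MonObj H] {M N : Mod C H} (f : M ⟶ N) :
    moduleAction M ≫ f.hom = H ◁ f.hom ≫ moduleAction N :=
  IsModHom.smul_hom (A := H) (f := f.hom)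

/-- An isomorphism of modules from an isomorphism of the underlying objects. -/
def moduleIso {H : C} [MonObj H] {M N : Mod C H} (e : M.X ≅ N.X)
    (h : moduleAction M ≫ e.hom = H ◁ e.hom ≫ moduleAction N) : M ≅ N where
  hom := Mod.Hom.mk' e.hom h
  inv := Mod.Hom.mk' e.inv (by
    change moduleAction N ≫ e.inv = H ◁ e.inv ≫ moduleAction M
    rw [Iso.comp_inv_eq, Category.assoc, h, whiskerLeft_inv_hom_assoc])
  hom_inv_id := Mod.hom_ext _ _ e.hom_inv_id
  inv_hom_id := Mod.hom_ext _ _ e.inv_hom_id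

variable [BraidedCategory C]

/-- The tensor product of `H`-modules, with the diagonal action. -/
def tensorModule {H : C} [BimonObj H] (M N : Mod C H) : Mod C H :=
  letI := tensorModObj H M.X N.X
  { X := M.X ⊗ N.X }

/-- The unit `H`-module. -/
def unitModule (H : C) [BimonObj H] : Mod C H :=
  letI := unitModObj H
  { X := 𝟙_ C }

theorem moduleAction_tensor {H : C} [BimonObj H] (M N : Mod C H) :
    moduleAction (tensorModule M N) =
      tensorComul H M.X N.X ≫ (moduleAction M ⊗ₘ moduleAction N) := rfl

theorem moduleAction_unit (H : C) [BimonObj H] :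
    moduleAction (unitModule H) = tensorCounit H := rfl

/-- The tensor product of two morphisms of modules. -/
def tensorModuleHom {H : C} [BimonObj H] {M M' N N' : Mod C H} (f : M ⟶ M') (g : N ⟶ N') :
    tensorModule M N ⟶ tensorModule M' N' :=
  Mod.Hom.mk' (f.hom ⊗ₘ g.hom) (by
    change (tensorComul H M.X N.X ≫ (moduleAction M ⊗ₘ moduleAction N)) ≫ (f.hom ⊗ₘ g.hom) =
      H ◁ (f.hom ⊗ₘ g.hom) ≫ tensorComul H M'.X N'.X ≫ (moduleAction M' ⊗ₘ moduleAction N')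
    rw [← reassoc_of% tensorComul_natural H f.hom g.hom, Category.assoc, tensorHom_comp_tensorHom,
      tensorHom_comp_tensorHom, moduleAction_hom, moduleAction_hom])

/-- The monoidal structure on `H`-modules; the underlying objects, morphisms and constraints are
those of `C`. -/
instance (H : C) [BimonObj H] : MonoidalCategoryStruct (Mod C H) where
  tensorObj := tensorModule
  tensorUnit := unitModule H
  tensorHom f g := tensorModuleHom f g
  whiskerLeft M _ _ f := tensorModuleHom (𝟙 M) f
  whiskerRight f N := tensorModuleHom f (𝟙 N)
  associator M N P := moduleIso (α_ M.X N.X P.X) (by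
    change (tensorComul H (M.X ⊗ N.X) P.X ≫
        ((tensorComul H M.X N.X ≫ (moduleAction M ⊗ₘ moduleAction N)) ⊗ₘ moduleAction P)) ≫
          (α_ M.X N.X P.X).hom = H ◁ (α_ M.X N.X P.X).hom ≫ tensorComul H M.X (N.X ⊗ P.X) ≫
        (moduleAction M ⊗ₘ (tensorComul H N.X P.X ≫ (moduleAction N ⊗ₘ moduleAction P)))
    have h := tensorComul_assoc H M.X N.X P.X
    have h1 : (tensorComul H M.X N.X ≫ (moduleAction M ⊗ₘ moduleAction N)) ⊗ₘ moduleAction P =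
        tensorComul H M.X N.X ▷ (H ⊗ P.X) ≫
          ((moduleAction M ⊗ₘ moduleAction N) ⊗ₘ moduleAction P) := by
      rw [← tensorHom_id, tensorHom_comp_tensorHom, Category.id_comp]
    have h2 : moduleAction M ⊗ₘ (tensorComul H N.X P.X ≫ (moduleAction N ⊗ₘ moduleAction P)) =
        (H ⊗ M.X) ◁ tensorComul H N.X P.X ≫
          (moduleAction M ⊗ₘ (moduleAction N ⊗ₘ moduleAction P)) := by
      rw [← id_tensorHom, tensorHom_comp_tensorHom, Category.id_comp]
    rw [h1, h2, ← reassoc_of% h, Category.assoc, Category.assoc, associator_naturality])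
  leftUnitor M := moduleIso (λ_ M.X) (by
    change (tensorComul H (𝟙_ C) M.X ≫ (tensorCounit H ⊗ₘ moduleAction M)) ≫ (λ_ M.X).hom =
      H ◁ (λ_ M.X).hom ≫ moduleAction M
    have h := tensorComul_counit_left H M.X
    rw [MonoidalCategory.tensorHom_def, Category.assoc, Category.assoc, leftUnitor_naturality,
      ← cancel_epi (H ◁ (λ_ M.X).inv), ← reassoc_of% h]
    simp)
  rightUnitor M := moduleIso (ρ_ M.X) (by
    change (tensorComul H M.X (𝟙_ C) ≫ (moduleAction M ⊗ₘ tensorCounit H)) ≫ (ρ_ M.X).hom =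
      H ◁ (ρ_ M.X).hom ≫ moduleAction M
    have h := tensorComul_counit_right H M.X
    rw [MonoidalCategory.tensorHom_def', Category.assoc, Category.assoc, rightUnitor_naturality,
      ← cancel_epi (H ◁ (ρ_ M.X).inv), ← reassoc_of% h]
    simp)

instance (H : C) [BimonObj H] : MonoidalCategory (Mod C H) where
  tensorHom_def f g := Mod.hom_ext _ _ (by
    change f.hom ⊗ₘ g.hom = (f.hom ⊗ₘ 𝟙 _) ≫ (𝟙 _ ⊗ₘ g.hom)
    rw [tensorHom_id, id_tensorHom, MonoidalCategory.tensorHom_def])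
  id_tensorHom_id M N := Mod.hom_ext _ _ (id_tensorHom_id M.X N.X)
  tensorHom_comp_tensorHom f g h k := Mod.hom_ext _ _
    (tensorHom_comp_tensorHom f.hom g.hom h.hom k.hom)
  whiskerLeft_id M N := Mod.hom_ext _ _ (id_tensorHom_id M.X N.X)
  id_whiskerRight M N := Mod.hom_ext _ _ (id_tensorHom_id M.X N.X)
  associator_naturality f g h := Mod.hom_ext _ _ (associator_naturality f.hom g.hom h.hom)
  leftUnitor_naturality {M N} f := Mod.hom_ext _ _ (by
    change (𝟙 (𝟙_ C) ⊗ₘ f.hom) ≫ (λ_ N.X).hom = (λ_ M.X).hom ≫ f.hom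
    simp)
  rightUnitor_naturality {M N} f := Mod.hom_ext _ _ (by
    change (f.hom ⊗ₘ 𝟙 (𝟙_ C)) ≫ (ρ_ N.X).hom = (ρ_ M.X).hom ≫ f.hom
    simp)
  pentagon M N P Q := Mod.hom_ext _ _ (by
    change ((α_ M.X N.X P.X).hom ⊗ₘ 𝟙 Q.X) ≫ (α_ M.X (N.X ⊗ P.X) Q.X).hom ≫
      (𝟙 M.X ⊗ₘ (α_ N.X P.X Q.X).hom) =
        (α_ (M.X ⊗ N.X) P.X Q.X).hom ≫ (α_ M.X N.X (P.X ⊗ Q.X)).hom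
    simp)
  triangle M N := Mod.hom_ext _ _ (by
    change (α_ M.X (𝟙_ C) N.X).hom ≫ (𝟙 M.X ⊗ₘ (λ_ N.X).hom) = ((ρ_ M.X).hom ⊗ₘ 𝟙 N.X)
    simp)

/-! ### The lifting data of a Hopf algebra -/

/-- `ν : H ⊗ S(H ⊗ X) ⟶ SX`: the braiding `c_{H,S(H ⊗ X)}`, then the antipode on `H`, then the
evaluation `e_{H,X}`. -/
def hopfNu {D : C} (L : LeftRaiser D) (H : C) [HopfObj H] (X : C) :
    H ⊗ L.hom (H ⊗ X) ⟶ L.hom X :=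
  (β_ H (L.hom (H ⊗ X))).hom ≫ L.hom (H ⊗ X) ◁ HopfObj.antipode ≫ L.evTensor H X

/-- `ν' : H ⊗ S'(H ⊗ X) ⟶ S'X`: the inverse antipode on `H` tensored with `S'` of the inverse
braiding `c_{H,X}⁻¹ : X ⊗ H ⟶ H ⊗ X`, then the evaluation `e'_{X,H}`. -/
def hopfNu' {D : C} (R : RightRaiser D) (H : C) [HopfObj H] [IsIso (HopfObj.antipode (X := H))]
    (X : C) : H ⊗ R.hom (H ⊗ X) ⟶ R.hom X :=
  (inv (HopfObj.antipode (X := H)) ⊗ₘ R.map (β_ H X).inv) ≫ R.evTensor X H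

/-- The `*`-autonomous structure `N` on `H`-modules lifts `M` along the forgetful functor, with the
actions on the duals given by `ν` and `ν'`: up to isomorphisms, the dualizing module has underlying
object `D`, the left dual of a module `A` has underlying object `SA`, action
`ν ∘ (H ⊗ S(action))` and the evaluation of `C`, and likewise for the right duals. -/
def LiftsStarAutonomous {H : C} [BimonObj H] (N : StarAutonomous (Mod C H)) (M : StarAutonomous C)
    (ν : ∀ X, H ⊗ M.left.hom (H ⊗ X) ⟶ M.left.hom X)
    (ν' : ∀ X, H ⊗ M.right.hom (H ⊗ X) ⟶ M.right.hom X) : Prop :=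
  ∃ d : N.D.X ≅ M.D,
    (∀ A : Mod C H, ∃ i : (N.left.hom A).X ≅ M.left.hom A.X,
      moduleAction (N.left.hom A) ≫ i.hom =
        H ◁ i.hom ≫ H ◁ M.left.map (moduleAction A) ≫ ν A.X ∧
      (N.left.ev A).hom ≫ d.hom = i.hom ▷ A.X ≫ M.left.ev A.X) ∧
    (∀ A : Mod C H, ∃ i : (N.right.hom A).X ≅ M.right.hom A.X,
      moduleAction (N.right.hom A) ≫ i.hom =
        H ◁ i.hom ≫ H ◁ M.right.map (moduleAction A) ≫ ν' A.X ∧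
      (N.right.ev A).hom ≫ d.hom = A.X ◁ i.hom ≫ M.right.ev A.X)

end Modules

end

/-! With elements and braidings suppressed, the dual actions follow two rules: ⟨h·φ, x⟩ = ⟨φ, σ(h)x⟩
on SX and ⟨x, h·ψ⟩ = ⟨σ⁻¹(h)x, ψ⟩ on S'X. Everything specific to Hopf algebras rests on
`invariant_iff` and its consequence `tensor_invariant_iff`: a pairing f : A ⊗ B → D is invariant
under the diagonal action exactly when f(h·x, y) = f(x, σ(h)·y). The rules above (`hopfNu_ev`,
`hopfNu'_ev`) solve this equation for the action on one factor. Hence the evaluations are invariant,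
and the transposes of an invariant pairing are module maps (`curry_leftDualAct`,
`curry_rightDualAct`).

For (a), the unit and multiplication axioms hold because σ preserves the unit and reverses products
up to the braiding, which matches the reversal caused by duality. In the axioms for α and β, σ
cancels σ⁻¹. The axioms for e_{A,B} and n_I say that transposes of invariant pairings are module
maps.

For (b), the right adjoint is Y ↦ S(H ⊗ S'Y), since Y ≅ SS'Y. The comonad axioms are formal and hold
for the mates of any *-autonomous opmonoidal monad: each is transposed along T ⊣ G and reduced by
naturality to the matching monad axiom. The axiom for e_{A,B} uses the T-algebras GA and GB.

For (c), D carries the trivial action. The bijections of the base category between maps A → SB,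
pairings A ⊗ B → D and maps B → S'A restrict to modules, by the criterion above. The functor S on
modules is an equivalence because α and β are invertible there: their underlying morphisms are the α
and β of the base, invertible by `isIso_raiserUnit` and `isIso_raiserCounit`. -/

noncomputable section

/-! ### Preliminaries on units and right duals -/

section Unit

variable {C : Type u} [Category.{v} C] [MonoidalCategory C]

theorem tensorMonad_η_whiskerRight (H X Y : C) [MonObj H] :
    ((λ_ X).inv ≫ MonObj.one (X := H) ▷ X) ▷ Y =
      (λ_ (X ⊗ Y)).inv ≫ MonObj.one ▷ (X ⊗ Y) ≫ (α_ H X Y).inv := by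
  simp

theorem tensorCounit_eq (H : C) [ComonObj H] :
    tensorCounit H = ComonObj.counit ▷ 𝟙_ C ≫ (λ_ (𝟙_ C)).hom := by
  rw [tensorCounit, ← unitors_equal.symm, rightUnitor_naturality]

namespace RightRaiser

variable {D : C} (R : RightRaiser D)

theorem map_id (A : C) : R.map (𝟙 A) = 𝟙 _ := R.hom_ext (by simp [map_ev])

theorem map_comp {X Y Z : C} (f : X ⟶ Y) (g : Y ⟶ Z) : R.map (f ≫ g) = R.map g ≫ R.map f :=
  R.hom_ext (by
    rw [map_ev, MonoidalCategory.whiskerLeft_comp, Category.assoc, map_ev, whisker_exchange_assoc,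
      map_ev]
    simp)

end RightRaiser

end Unit

/-! ### Calculus of moving an object past a tensor factor -/

section Crossing

variable {C : Type u} [Category.{v} C] [MonoidalCategory C] [BraidedCategory C]

/-- The isomorphism `K ⊗ (A ⊗ B) ≅ A ⊗ (K ⊗ B)` given by the braiding `c_{K,A}`. -/
def crossing (K A B : C) : K ⊗ (A ⊗ B) ≅ A ⊗ (K ⊗ B) :=
  (α_ K A B).symm ≪≫ whiskerRightIso (β_ K A) B ≪≫ α_ A K B

theorem crossing_hom (K A B : C) :
    (crossing K A B).hom = (α_ K A B).inv ≫ (β_ K A).hom ▷ B ≫ (α_ A K B).hom := rfl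

theorem crossing_inv (K A B : C) :
    (crossing K A B).inv = (α_ A K B).inv ≫ (β_ K A).inv ▷ B ≫ (α_ K A B).hom := by
  simp [crossing]

theorem crossing_naturality_left {K K' : C} (f : K ⟶ K') (A B : C) :
    f ▷ (A ⊗ B) ≫ (crossing K' A B).hom = (crossing K A B).hom ≫ A ◁ f ▷ B := by
  simp only [crossing_hom, Category.assoc]
  rw [associator_inv_naturality_left_assoc, ← comp_whiskerRight_assoc,
    BraidedCategory.braiding_naturality_left]
  simp

theorem crossing_naturality_middle (K : C) {A A' : C} (f : A ⟶ A') (B : C) :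
    K ◁ f ▷ B ≫ (crossing K A' B).hom = (crossing K A B).hom ≫ f ▷ (K ⊗ B) := by
  simp only [crossing_hom, Category.assoc]
  rw [associator_inv_naturality_middle_assoc, ← comp_whiskerRight_assoc,
    BraidedCategory.braiding_naturality_right]
  simp

theorem crossing_naturality_right (K A : C) {B B' : C} (f : B ⟶ B') :
    K ◁ A ◁ f ≫ (crossing K A B').hom = (crossing K A B).hom ≫ A ◁ K ◁ f := by
  simp only [crossing_hom, Category.assoc]
  rw [associator_inv_naturality_right_assoc, whisker_exchange_assoc]
  simp

theorem crossing_inv_naturality_right (K A : C) {B B' : C} (f : B ⟶ B') :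
    A ◁ K ◁ f ≫ (crossing K A B').inv = (crossing K A B).inv ≫ K ◁ A ◁ f := by
  rw [Iso.comp_inv_eq, Category.assoc, crossing_naturality_right, Iso.inv_hom_id_assoc]

theorem crossing_tensor_left (K K' A B : C) :
    (crossing (K ⊗ K') A B).hom = (α_ K K' (A ⊗ B)).hom ≫ K ◁ (crossing K' A B).hom ≫
      (crossing K A (K' ⊗ B)).hom ≫ A ◁ (α_ K K' B).inv := by
  simp only [crossing_hom, BraidedCategory.braiding_tensor_left_hom]
  monoidal

theorem crossing_tensor_middle (K A B X : C) :
    (crossing K (A ⊗ B) X).hom = K ◁ (α_ A B X).hom ≫ (crossing K A (B ⊗ X)).hom ≫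
      A ◁ (crossing K B X).hom ≫ (α_ A B (K ⊗ X)).inv := by
  simp only [crossing_hom, BraidedCategory.braiding_tensor_right_hom]
  monoidal

theorem crossing_unit (A B : C) :
    (crossing (𝟙_ C) A B).hom = (λ_ (A ⊗ B)).hom ≫ A ◁ (λ_ B).inv := by
  simp only [crossing_hom, braiding_tensorUnit_left]
  monoidal

theorem crossing_hom_eq_tensorμ (H K A B : C) :
    tensorμ H K A B = (α_ H K (A ⊗ B)).hom ≫ H ◁ (crossing K A B).hom ≫ (α_ H A (K ⊗ B)).inv := by
  simp [tensorμ, crossing_hom]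

/-- A Yang–Baxter relation: naturality of the crossing past A, applied to the braiding of K with K'.
In `hopfNu_mul` it produces the c_{H,H} that the antihomomorphism law of the antipode requires. -/
theorem crossing_crossing (K K' A B : C) :
    (crossing K K' (A ⊗ B)).hom ≫ K' ◁ (crossing K A B).hom ≫ (crossing K' A (K ⊗ B)).hom =
      (α_ K K' (A ⊗ B)).inv ≫ (crossing (K ⊗ K') A B).hom ≫
        A ◁ ((β_ K K').hom ▷ B ≫ (α_ K' K B).hom) := by
  rw [MonoidalCategory.whiskerLeft_comp, ← reassoc_of% crossing_naturality_left,
    crossing_tensor_left,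
    crossing_hom K K']
  simp

end Crossing

/-! ### The monad H ⊗ - is *-autonomous -/

section Hopf

variable {C : Type u} [Category.{v} C] [MonoidalCategory C] [BraidedCategory C]

/-- The diagonal action is a convolution: the second leg of the comultiplication acts first, on the
right factor through the braiding, and then the first leg acts on the left factor. This is the shape
required by `invariant_iff`. -/
theorem tensorComul_tensorHom (H : C) [ComonObj H] {A B : C} {A' B' : C} (a : H ⊗ A ⟶ A')
    (b : H ⊗ B ⟶ B') :
    tensorComul H A B ≫ (a ⊗ₘ b) = ComonObj.comul ▷ (A ⊗ B) ≫ (α_ H H (A ⊗ B)).hom ≫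
      H ◁ ((crossing H A B).hom ≫ A ◁ b) ≫ (α_ H A B').inv ≫ a ▷ B' := by
  simp only [tensorComul, crossing_hom_eq_tensorμ, MonoidalCategory.tensorHom_def', Category.assoc,
    MonoidalCategory.whiskerLeft_comp]
  rw [associator_inv_naturality_right_assoc]

/-- If `q` is an action of `H` on `X`, then a morphism `f` is invariant under the convolution of
`p` and `q` exactly when `p` agrees with the antipode followed by `q` after composition with `f`. -/
theorem invariant_iff (H : C) [HopfObj H] {X D : C} (p q : H ⊗ X ⟶ X)
    (one : MonObj.one ▷ X ≫ q = (λ_ X).hom)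
    (mul : MonObj.mul ▷ X ≫ q = (α_ H H X).hom ≫ H ◁ q ≫ q) (f : X ⟶ D) :
    ComonObj.comul ▷ X ≫ (α_ H H X).hom ≫ H ◁ q ≫ p ≫ f =
        H ◁ f ≫ ComonObj.counit ▷ D ≫ (λ_ D).hom ↔
      p ≫ f = HopfObj.antipode ▷ X ≫ q ≫ f := by
  have h0 : ComonObj.counit (X := H) ▷ X ≫ MonObj.one (X := H) ▷ X ≫ q ≫ f =
      H ◁ f ≫ ComonObj.counit ▷ D ≫ (λ_ D).hom := by
    rw [reassoc_of% one, whisker_exchange_assoc, leftUnitor_naturality]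
  constructor
  -- In Sweedler notation, f(p(h, x)) = f(p(h₁, h₂·σ(h₃)·x)) = ε(h₁) f(σ(h₂)·x) = f(σ(h)·x). The
  -- equalities are `h1`, the hypothesis and `h2`; `h3` is the coassociativity that regroups the
  -- legs.
  · intro h
    have h1 : ComonObj.comul (X := H) ▷ X ≫ (α_ H H X).hom ≫
        H ◁ (HopfObj.antipode (X := H) ▷ X ≫ q) ≫ q =
        ComonObj.counit ▷ X ≫ (λ_ X).hom := by
      have := HopfObj.antipode_right H
      rw [MonoidalCategory.whiskerLeft_comp, Category.assoc, ← associator_naturality_middle_assoc,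
        ← mul, ← comp_whiskerRight_assoc, ← comp_whiskerRight_assoc, Category.assoc, this,
        comp_whiskerRight_assoc, one]
    have h2 : ComonObj.comul (X := H) ▷ X ≫ (α_ H H X).hom ≫
        H ◁ (HopfObj.antipode (X := H) ▷ X ≫ q) ≫ (H ◁ f ≫ ComonObj.counit ▷ D ≫ (λ_ D).hom) =
        HopfObj.antipode ▷ X ≫ q ≫ f := by
      rw [whisker_exchange_assoc, whisker_exchange_assoc, leftUnitor_naturality,
        leftUnitor_naturality_assoc, ← associator_naturality_left_assoc, leftUnitor_tensor_hom]
      simp only [Category.assoc, Iso.hom_inv_id_assoc]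
      rw [← comp_whiskerRight_assoc, ComonObj.counit_comul]
      simp
    have h3 : ComonObj.comul (X := H) ▷ X ≫ (α_ H H X).hom ≫ ComonObj.comul ▷ (H ⊗ X) ≫
        (α_ H H (H ⊗ X)).hom =
        ComonObj.comul ▷ X ≫ (α_ H H X).hom ≫ H ◁ (ComonObj.comul ▷ X ≫ (α_ H H X).hom) := by
      rw [MonoidalCategory.whiskerLeft_comp, ← associator_naturality_middle_assoc,
        ← comp_whiskerRight_assoc, ComonObj.comul_assoc, ← associator_naturality_left_assoc]
      simp
    rw [← h2, ← h, whisker_exchange_assoc, associator_naturality_right_assoc, reassoc_of% h3,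
      ← whiskerLeft_comp_assoc, ← whiskerLeft_comp_assoc, Category.assoc, Category.assoc, h1,
      MonoidalCategory.whiskerLeft_comp, Category.assoc, ← associator_naturality_middle_assoc,
      ← comp_whiskerRight_assoc, ComonObj.comul_counit]
    simp
  -- Here f(σ(h₁)·h₂·x) = ε(h) f(x), by associativity of q and the other antipode law.
  · intro h
    rw [h, whisker_exchange_assoc]
    rw [← h0, ← associator_naturality_left_assoc, ← reassoc_of% mul]
    have := HopfObj.antipode_left H
    simp only [← comp_whiskerRight_assoc, this]

/-- The left factor acts on `A ⊗ B`. -/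
def actLeft {H A A' : C} (a : H ⊗ A ⟶ A') (B : C) : H ⊗ (A ⊗ B) ⟶ A' ⊗ B := (α_ H A B).inv ≫ a ▷ B

/-- The right factor acts on `A ⊗ B`, through the braiding. -/
def actRight {H B B' : C} (A : C) (b : H ⊗ B ⟶ B') : H ⊗ (A ⊗ B) ⟶ A ⊗ B' :=
  (crossing H A B).hom ≫ A ◁ b

theorem one_actRight {H B : C} [MonObj H] (A : C) (b : H ⊗ B ⟶ B)
    (one : MonObj.one ▷ B ≫ b = (λ_ B).hom) :
    MonObj.one ▷ (A ⊗ B) ≫ actRight A b = (λ_ (A ⊗ B)).hom := by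
  rw [actRight, reassoc_of% crossing_naturality_left, ← MonoidalCategory.whiskerLeft_comp, one,
    crossing_unit]
  simp

theorem mul_actRight {H B : C} [MonObj H] (A : C) (b : H ⊗ B ⟶ B)
    (mul : MonObj.mul ▷ B ≫ b = (α_ H H B).hom ≫ H ◁ b ≫ b) :
    MonObj.mul ▷ (A ⊗ B) ≫ actRight A b =
      (α_ H H (A ⊗ B)).hom ≫ H ◁ actRight A b ≫ actRight A b := by
  rw [actRight, reassoc_of% crossing_naturality_left, ← MonoidalCategory.whiskerLeft_comp, mul,
    crossing_tensor_left, MonoidalCategory.whiskerLeft_comp H]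
  simp only [Category.assoc]
  rw [reassoc_of% crossing_naturality_right]
  simp

/-- A morphism `A ⊗ B ⟶ D` is invariant under the diagonal action exactly when the action on `A`
is adjoint to the action of the antipode on `B`. -/
theorem tensor_invariant_iff (H : C) [HopfObj H] {A B D : C} (a : H ⊗ A ⟶ A) (b : H ⊗ B ⟶ B)
    (one : MonObj.one ▷ B ≫ b = (λ_ B).hom)
    (mul : MonObj.mul ▷ B ≫ b = (α_ H H B).hom ≫ H ◁ b ≫ b) (f : A ⊗ B ⟶ D) :
    tensorComul H A B ≫ (a ⊗ₘ b) ≫ f = H ◁ f ≫ ComonObj.counit ▷ D ≫ (λ_ D).hom ↔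
      actLeft a B ≫ f = HopfObj.antipode ▷ (A ⊗ B) ≫ actRight A b ≫ f := by
  rw [← invariant_iff H (actLeft a B) (actRight A b) (one_actRight A b one)
    (mul_actRight A b mul), ← Category.assoc (tensorComul H A B), tensorComul_tensorHom]
  simp only [actLeft, actRight, Category.assoc]

/-- The rule ⟨h·φ, x⟩ = ⟨φ, σ(h) ⊗ x⟩. Morphisms into SX are determined by their evaluations, so
this characterises ν and is the form in which its identities are checked. -/
theorem hopfNu_ev {D : C} (L : LeftRaiser D) (H : C) [HopfObj H] (X : C) :
    actLeft (hopfNu L H X) X ≫ L.ev X =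
      (crossing H (L.hom (H ⊗ X)) X).hom ≫ L.hom (H ⊗ X) ◁ HopfObj.antipode ▷ X ≫
        L.ev (H ⊗ X) := by
  simp [actLeft, hopfNu, crossing_hom, L.evTensor_ev]

/-- The rule ⟨x, h·ψ⟩ = ⟨σ⁻¹(h) ⊗ x, ψ⟩. The factor S'(c⁻¹) in ν' cancels the braiding needed to
bring h past x, so none remains on the right-hand side. -/
theorem hopfNu'_ev {D : C} (R : RightRaiser D) (H : C) [HopfObj H]
    [IsIso (HopfObj.antipode (X := H))] (X : C) :
    (crossing H X (R.hom (H ⊗ X))).hom ≫ X ◁ hopfNu' R H X ≫ R.ev X =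
      inv (HopfObj.antipode (X := H)) ▷ (X ⊗ R.hom (H ⊗ X)) ≫ (α_ _ _ _).inv ≫
        R.ev (H ⊗ X) := by
  have h : X ◁ H ◁ R.map (β_ H X).inv ≫ (α_ _ _ _).inv ≫ R.ev (X ⊗ H) =
      (α_ _ _ _).inv ≫ (β_ H X).inv ▷ _ ≫ R.ev (H ⊗ X) := by
    rw [associator_inv_naturality_right_assoc, R.map_ev]
  rw [hopfNu', MonoidalCategory.whiskerLeft_comp, Category.assoc, R.evTensor_ev,
    MonoidalCategory.tensorHom_def, MonoidalCategory.whiskerLeft_comp, Category.assoc, h,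
    ← reassoc_of% crossing_naturality_left]
  simp [crossing_hom]


theorem crossing_one (H X Y : C) [MonObj H] :
    (λ_ (X ⊗ Y)).inv ≫ MonObj.one ▷ (X ⊗ Y) ≫ (crossing H X Y).hom =
      X ◁ ((λ_ Y).inv ≫ MonObj.one ▷ Y) := by
  rw [crossing_naturality_left, crossing_unit]
  simp

theorem hopfNu_naturality {D : C} (L : LeftRaiser D) (H : C) [HopfObj H] {X Y : C} (f : X ⟶ Y) :
    H ◁ L.map (H ◁ f) ≫ hopfNu L H X = hopfNu L H Y ≫ L.map f := by
  apply L.hom_ext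
  have h1 := hopfNu_ev L H X
  have h2 := hopfNu_ev L H Y
  simp only [actLeft, Category.assoc] at h1 h2
  rw [comp_whiskerRight, comp_whiskerRight, Category.assoc, Category.assoc, L.map_ev,
    ← whisker_exchange_assoc, ← cancel_epi (α_ _ _ _).inv, ← associator_inv_naturality_middle_assoc,
    h1, ← associator_inv_naturality_right_assoc, h2, reassoc_of% crossing_naturality_right,
    reassoc_of% crossing_naturality_middle, ← whisker_exchange_assoc, L.map_ev]
  simp only [← whiskerLeft_comp_assoc, whisker_exchange]

theorem hopfNu'_naturality {D : C} (R : RightRaiser D) (H : C) [HopfObj H]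
    [IsIso (HopfObj.antipode (X := H))] {X Y : C} (f : X ⟶ Y) :
    H ◁ R.map (H ◁ f) ≫ hopfNu' R H X = hopfNu' R H Y ≫ R.map f := by
  apply R.hom_ext
  have h1 := hopfNu'_ev R H X
  have h2 := hopfNu'_ev R H Y
  rw [MonoidalCategory.whiskerLeft_comp, MonoidalCategory.whiskerLeft_comp, Category.assoc,
    Category.assoc, R.map_ev, whisker_exchange_assoc, ← cancel_epi (crossing _ _ _).hom,
    ← reassoc_of% crossing_naturality_right, h1, ← reassoc_of% crossing_naturality_middle, h2,
    whisker_exchange_assoc, whisker_exchange_assoc, associator_inv_naturality_right_assoc, R.map_ev,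
    associator_inv_naturality_middle_assoc]

theorem hopfNu_unit {D : C} (L : LeftRaiser D) (H : C) [HopfObj H] (X : C) :
    ((λ_ (L.hom (H ⊗ X))).inv ≫ MonObj.one ▷ L.hom (H ⊗ X)) ≫ hopfNu L H X =
      L.map ((λ_ X).inv ≫ MonObj.one ▷ X) := by
  apply L.hom_ext
  have h1 := hopfNu_ev L H X
  simp only [actLeft, Category.assoc] at h1
  rw [L.map_ev, comp_whiskerRight, tensorMonad_η_whiskerRight]
  simp only [Category.assoc]
  rw [h1, ← crossing_one]
  simp only [Category.assoc]
  rw [← reassoc_of% crossing_naturality_left, ← comp_whiskerRight_assoc, HopfObj.one_antipode]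

theorem hopfNu'_unit {D : C} (R : RightRaiser D) (H : C) [HopfObj H]
    [IsIso (HopfObj.antipode (X := H))] (X : C) :
    ((λ_ (R.hom (H ⊗ X))).inv ≫ MonObj.one ▷ R.hom (H ⊗ X)) ≫ hopfNu' R H X =
      R.map ((λ_ X).inv ≫ MonObj.one ▷ X) := by
  apply R.hom_ext
  have h1 := hopfNu'_ev R H X
  have h2 : MonObj.one ≫ inv (HopfObj.antipode (X := H)) = MonObj.one := by
    rw [IsIso.comp_inv_eq, HopfObj.one_antipode]
  rw [R.map_ev, MonoidalCategory.whiskerLeft_comp, ← crossing_one, tensorMonad_η_whiskerRight]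
  simp only [Category.assoc]
  rw [h1, ← comp_whiskerRight_assoc, h2]

/-- The antihomomorphism law of σ, transported to its inverse; this replaces c by c⁻¹. -/
theorem mul_inv_antipode (H : C) [HopfObj H] [IsIso (HopfObj.antipode (X := H))] :
    MonObj.mul ≫ inv (HopfObj.antipode (X := H)) =
      (β_ H H).inv ≫ (inv HopfObj.antipode ⊗ₘ inv HopfObj.antipode) ≫ MonObj.mul := by
  rw [IsIso.comp_inv_eq]
  simp only [Category.assoc]
  rw [HopfObj.mul_antipode, tensorHom_comp_tensorHom_assoc, Iso.eq_inv_comp]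
  simp

/-- Acting by a product brings in σ(hk), a product in reversed order after the braiding c_{H,H}.
Acting by k and then by h also reverses the order, and crossing the two copies of H one at a time
yields the same braiding. -/
theorem hopfNu_mul {D : C} (L : LeftRaiser D) (H : C) [HopfObj H] (X : C) :
    ((α_ H H (L.hom (H ⊗ X))).inv ≫ MonObj.mul ▷ L.hom (H ⊗ X)) ≫ hopfNu L H X =
      H ◁ H ◁ L.map ((α_ H H X).inv ≫ MonObj.mul ▷ X) ≫ H ◁ hopfNu L H (H ⊗ X) ≫
        hopfNu L H X := by
  apply L.hom_ext
  have h1 := hopfNu_ev L H X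
  have h2 := hopfNu_ev L H (H ⊗ X)
  simp only [actLeft, Category.assoc] at h1 h2
  rw [← cancel_epi (α_ _ _ _).inv, ← cancel_epi (H ◁ (α_ _ _ _).inv)]
  simp only [comp_whiskerRight, Category.assoc]
  have e1 : H ◁ (α_ H (L.hom (H ⊗ X)) X).inv ≫ (α_ H (H ⊗ L.hom (H ⊗ X)) X).inv ≫
      (α_ H H (L.hom (H ⊗ X))).inv ▷ X = (α_ H H _).inv ≫ (α_ (H ⊗ H) _ X).inv := by
    simp
  rw [reassoc_of% e1, ← associator_inv_naturality_left_assoc, h1,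
    reassoc_of% crossing_naturality_left, ← whiskerLeft_comp_assoc, ← comp_whiskerRight,
    HopfObj.mul_antipode]
  rw [← associator_inv_naturality_middle_assoc, ← associator_inv_naturality_middle_assoc, h1,
    reassoc_of% crossing_naturality_middle, reassoc_of% crossing_naturality_middle,
    ← whisker_exchange_assoc, ← whisker_exchange_assoc]
  rw [← cancel_epi (H ◁ (α_ _ _ _).hom), whiskerLeft_hom_inv_assoc]
  have h3 : (hopfNu L H (H ⊗ X)) ▷ (H ⊗ X) ≫ L.ev (H ⊗ X) = (α_ _ _ _).hom ≫
    (crossing H _ _).hom ≫ L.hom (H ⊗ H ⊗ X) ◁ HopfObj.antipode ▷ (H ⊗ X) ≫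
        L.ev (H ⊗ H ⊗ X) := by
    rw [← h2]; simp
  rw [h3, crossing_tensor_middle]
  simp only [Category.assoc]
  rw [associator_naturality_middle_assoc, reassoc_of% crossing_naturality_middle,
    ← whisker_exchange_assoc, L.map_ev, associator_naturality_right_assoc,
    reassoc_of% crossing_naturality_right, Iso.inv_hom_id_assoc, reassoc_of% crossing_crossing]
  -- Naturality moves both antipodes past c_{H,H}, where they appear separately as in the iterated
  -- action.
  have h4 : ((HopfObj.antipode (X := H) ⊗ₘ HopfObj.antipode (X := H)) ≫ (β_ H H).hom ≫
      MonObj.mul) ▷ X = ((β_ H H).hom ▷ X ≫ (α_ H H X).hom) ≫ H ◁ HopfObj.antipode ▷ X ≫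
        HopfObj.antipode ▷ (H ⊗ X) ≫ (α_ H H X).inv ≫ MonObj.mul ▷ X := by
    rw [BraidedCategory.braiding_naturality_assoc, MonoidalCategory.tensorHom_def']
    simp
  rw [h4]
  simp only [MonoidalCategory.whiskerLeft_comp, Category.assoc]

/-- The argument of `hopfNu_mul` with σ⁻¹: the inverse braiding from `mul_inv_antipode` meets the
one that arises from undoing the crossing of H past H ⊗ X. -/
theorem hopfNu'_mul {D : C} (R : RightRaiser D) (H : C) [HopfObj H]
    [IsIso (HopfObj.antipode (X := H))] (X : C) :
    ((α_ H H (R.hom (H ⊗ X))).inv ≫ MonObj.mul ▷ R.hom (H ⊗ X)) ≫ hopfNu' R H X =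
      H ◁ H ◁ R.map ((α_ H H X).inv ≫ MonObj.mul ▷ X) ≫ H ◁ hopfNu' R H (H ⊗ X) ≫
        hopfNu' R H X := by
  apply R.hom_ext
  have h1 := hopfNu'_ev R H X
  have h2 := hopfNu'_ev R H (H ⊗ X)
  rw [← cancel_epi (crossing H X _).hom, ← cancel_epi (H ◁ (crossing H X _).hom)]
  simp only [MonoidalCategory.whiskerLeft_comp, Category.assoc]
  have e1 : H ◁ (crossing H X (R.hom (H ⊗ X))).hom ≫ (crossing H X (H ⊗ R.hom (H ⊗ X))).hom ≫
      X ◁ (α_ H H (R.hom (H ⊗ X))).inv = (α_ H H _).inv ≫ (crossing (H ⊗ H) X _).hom := by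
    rw [crossing_tensor_left, Iso.inv_hom_id_assoc]
  rw [reassoc_of% e1, ← reassoc_of% crossing_naturality_left, h1,
    ← reassoc_of% crossing_naturality_right,
    ← reassoc_of% crossing_naturality_right, h1, ← comp_whiskerRight_assoc, mul_inv_antipode]
  have h3 : (H ⊗ X) ◁ hopfNu' R H (H ⊗ X) ≫ R.ev (H ⊗ X) = (crossing H (H ⊗ X) _).inv ≫
      inv (HopfObj.antipode (X := H)) ▷ _ ≫ (α_ _ _ _).inv ≫ R.ev (H ⊗ H ⊗ X) := by
    rw [← h2, Iso.inv_hom_id_assoc]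
  rw [whisker_exchange_assoc, whisker_exchange_assoc, associator_inv_naturality_right_assoc,
    associator_inv_naturality_right_assoc, h3]
  -- By the hexagon, the crossing past H ⊗ X is the crossing past H followed by the one past X. The
  -- part past X cancels, leaving only the inverse crossing past H.
  have e2 : H ◁ (crossing H X (R.hom (H ⊗ X))).hom ≫ (α_ H X _).inv ≫
      (crossing H (H ⊗ X) (R.hom (H ⊗ X))).inv =
      (crossing H H (X ⊗ R.hom (H ⊗ X))).inv ≫ H ◁ (α_ H X _).inv := by
    rw [Iso.eq_inv_comp, ← Category.assoc, ← Category.assoc, Iso.comp_inv_eq,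
      crossing_tensor_middle]
    simp
  have e3 : inv (HopfObj.antipode (X := H)) ▷ H ≫ (β_ H H).inv =
      (β_ H H).inv ≫ H ◁ inv HopfObj.antipode := by
    rw [Iso.comp_inv_eq, Category.assoc, BraidedCategory.braiding_naturality_right,
      Iso.inv_hom_id_assoc]
  rw [whisker_exchange_assoc, reassoc_of% crossing_inv_naturality_right, reassoc_of% e2,
    whisker_exchange_assoc, associator_inv_naturality_right_assoc, R.map_ev, crossing_inv]
  simp only [Category.assoc]
  have e4 (Y : C) : inv (HopfObj.antipode (X := H)) ▷ (H ⊗ Y) ≫ (α_ H H Y).inv ≫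
      (β_ H H).inv ▷ Y = (α_ H H Y).inv ≫ ((β_ H H).inv ≫ H ◁ inv HopfObj.antipode) ▷ Y := by
    rw [← e3]
    simp only [comp_whiskerRight, whiskerRight_tensor,
      Category.assoc, Iso.hom_inv_id_assoc]
  rw [reassoc_of% e4, MonoidalCategory.tensorHom_def']
  simp

/-- The action on `SX` induced by an action on `X`. -/
abbrev leftDualAct {D : C} (L : LeftRaiser D) {H : C} [HopfObj H] {X : C} (a : H ⊗ X ⟶ X) :
    H ⊗ L.hom X ⟶ L.hom X :=
  H ◁ L.map a ≫ hopfNu L H X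

/-- The action on `S'X` induced by an action on `X`. -/
abbrev rightDualAct {D : C} (R : RightRaiser D) {H : C} [HopfObj H]
    [IsIso (HopfObj.antipode (X := H))] {X : C} (a : H ⊗ X ⟶ X) : H ⊗ R.hom X ⟶ R.hom X :=
  H ◁ R.map a ≫ hopfNu' R H X

/-- The rule ⟨h·φ, x⟩ = ⟨φ, σ(h)·x⟩, which is the right-hand condition of `tensor_invariant_iff` for
the evaluation. -/
theorem leftDualAct_ev {D : C} (L : LeftRaiser D) {H : C} [HopfObj H] {X : C} (a : H ⊗ X ⟶ X) :
    actLeft (leftDualAct L a) X ≫ L.ev X =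
      HopfObj.antipode ▷ (L.hom X ⊗ X) ≫ actRight (L.hom X) a ≫ L.ev X := by
  have h := hopfNu_ev L H X
  simp only [actLeft, actRight, Category.assoc] at h ⊢
  rw [leftDualAct, comp_whiskerRight_assoc, ← associator_inv_naturality_middle_assoc, h,
    reassoc_of% crossing_naturality_middle, ← whisker_exchange_assoc, L.map_ev,
    reassoc_of% crossing_naturality_left]

theorem rightDualAct_ev {D : C} (R : RightRaiser D) {H : C} [HopfObj H]
    [IsIso (HopfObj.antipode (X := H))] {X : C} (a : H ⊗ X ⟶ X) :
    actRight X (rightDualAct R a) ≫ R.ev X =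
      inv (HopfObj.antipode (X := H)) ▷ (X ⊗ R.hom X) ≫ actLeft a (R.hom X) ≫ R.ev X := by
  simp only [actLeft, actRight, Category.assoc]
  rw [rightDualAct, MonoidalCategory.whiskerLeft_comp, Category.assoc,
    ← reassoc_of% crossing_naturality_right, hopfNu'_ev, whisker_exchange_assoc,
    associator_inv_naturality_right_assoc, R.map_ev]

/-- After evaluation the two sides are f(h·x, y) and f(x, σ(h)·y), so the hypothesis is what is
needed. Combined with `tensor_invariant_iff`, this makes the transpose of an invariant pairing a
module map. -/
theorem curry_leftDualAct {D : C} (L : LeftRaiser D) {H : C} [HopfObj H] {A B : C}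
    (a : H ⊗ A ⟶ A) (b : H ⊗ B ⟶ B) (f : A ⊗ B ⟶ D)
    (h : actLeft a B ≫ f = HopfObj.antipode ▷ (A ⊗ B) ≫ actRight A b ≫ f) :
    a ≫ L.curry f = H ◁ L.curry f ≫ leftDualAct L b := by
  have h1 := leftDualAct_ev L b
  simp only [actLeft, actRight, Category.assoc] at h h1
  apply L.hom_ext
  rw [comp_whiskerRight_assoc, comp_whiskerRight_assoc, L.curry_ev, ← cancel_epi (α_ _ _ _).inv, h,
    ← associator_inv_naturality_middle_assoc, h1, whisker_exchange_assoc,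
    reassoc_of% crossing_naturality_middle, ← whisker_exchange_assoc, L.curry_ev]

/-- The same hypothesis serves on the other side, once h is replaced by σ⁻¹(h). -/
theorem curry_rightDualAct {D : C} (R : RightRaiser D) {H : C} [HopfObj H]
    [IsIso (HopfObj.antipode (X := H))] {A B : C}
    (a : H ⊗ A ⟶ A) (b : H ⊗ B ⟶ B) (f : A ⊗ B ⟶ D)
    (h : actLeft a B ≫ f = HopfObj.antipode ▷ (A ⊗ B) ≫ actRight A b ≫ f) :
    b ≫ R.curry f = H ◁ R.curry f ≫ rightDualAct R a := by
  have h1 := rightDualAct_ev R a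
  simp only [actLeft, actRight, Category.assoc] at h h1
  apply R.hom_ext
  rw [whiskerLeft_comp_assoc, whiskerLeft_comp_assoc, R.curry_ev,
    ← cancel_epi (crossing _ _ _).hom, ← reassoc_of% crossing_naturality_right, h1,
    whisker_exchange_assoc, associator_inv_naturality_right_assoc, whisker_exchange_assoc,
    R.curry_ev, h, ← comp_whiskerRight_assoc, IsIso.inv_hom_id, id_whiskerRight, Category.id_comp]

theorem leftDualAct_ev_invariant {D : C} (L : LeftRaiser D) {H : C} [HopfObj H] {X : C}
    (a : H ⊗ X ⟶ X) (one : MonObj.one ▷ X ≫ a = (λ_ X).hom)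
    (mul : MonObj.mul ▷ X ≫ a = (α_ H H X).hom ≫ H ◁ a ≫ a) :
    tensorComul H (L.hom X) X ≫ (leftDualAct L a ⊗ₘ a) ≫ L.ev X =
      H ◁ L.ev X ≫ ComonObj.counit ▷ D ≫ (λ_ D).hom := by
  rw [tensor_invariant_iff H _ a one mul, leftDualAct_ev]

/-- The criterion needs a genuine action on the second factor, which is now S'X; this is why the
module laws are assumed for the dual action and not for `a`. -/
theorem rightDualAct_ev_invariant {D : C} (R : RightRaiser D) {H : C} [HopfObj H]
    [IsIso (HopfObj.antipode (X := H))] {X : C} (a : H ⊗ X ⟶ X)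
    (one : MonObj.one ▷ R.hom X ≫ rightDualAct R a = (λ_ (R.hom X)).hom)
    (mul : MonObj.mul ▷ R.hom X ≫ rightDualAct R a =
      (α_ H H (R.hom X)).hom ≫ H ◁ rightDualAct R a ≫ rightDualAct R a) :
    tensorComul H X (R.hom X) ≫ (a ⊗ₘ rightDualAct R a) ≫ R.ev X =
      H ◁ R.ev X ≫ ComonObj.counit ▷ D ≫ (λ_ D).hom := by
  rw [tensor_invariant_iff H _ _ one mul, rightDualAct_ev, ← comp_whiskerRight_assoc,
    IsIso.hom_inv_id, id_whiskerRight, Category.id_comp]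

theorem leftDualAct_one {D : C} (L : LeftRaiser D) {H : C} [HopfObj H] {X : C}
    (a : H ⊗ X ⟶ X) (one : MonObj.one ▷ X ≫ a = (λ_ X).hom) :
    MonObj.one ▷ L.hom X ≫ leftDualAct L a = (λ_ (L.hom X)).hom := by
  have h := hopfNu_unit L H X
  rw [Category.assoc, Iso.inv_comp_eq] at h
  rw [leftDualAct, ← whisker_exchange_assoc, h, leftUnitor_naturality_assoc, ← L.map_comp,
    Category.assoc, one, Iso.inv_hom_id, L.map_id, Category.comp_id]

theorem rightDualAct_one {D : C} (R : RightRaiser D) {H : C} [HopfObj H]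
    [IsIso (HopfObj.antipode (X := H))] {X : C}
    (a : H ⊗ X ⟶ X) (one : MonObj.one ▷ X ≫ a = (λ_ X).hom) :
    MonObj.one ▷ R.hom X ≫ rightDualAct R a = (λ_ (R.hom X)).hom := by
  have h := hopfNu'_unit R H X
  rw [Category.assoc, Iso.inv_comp_eq] at h
  rw [rightDualAct, ← whisker_exchange_assoc, h, leftUnitor_naturality_assoc, ← R.map_comp,
    Category.assoc, one, Iso.inv_hom_id, R.map_id, Category.comp_id]

theorem leftDualAct_mul {D : C} (L : LeftRaiser D) {H : C} [HopfObj H] {X : C}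
    (a : H ⊗ X ⟶ X) (mul : MonObj.mul ▷ X ≫ a = (α_ H H X).hom ≫ H ◁ a ≫ a) :
    MonObj.mul ▷ L.hom X ≫ leftDualAct L a =
      (α_ H H (L.hom X)).hom ≫ H ◁ leftDualAct L a ≫ leftDualAct L a := by
  have h := hopfNu_mul L H X
  rw [Category.assoc, Iso.inv_comp_eq] at h
  rw [leftDualAct, ← whisker_exchange_assoc, h, associator_naturality_right_assoc]
  simp only [← whiskerLeft_comp_assoc, Category.assoc]
  rw [← hopfNu_naturality, ← L.map_comp, Category.assoc, mul, Iso.inv_hom_id_assoc, L.map_comp]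
  simp

theorem rightDualAct_mul {D : C} (R : RightRaiser D) {H : C} [HopfObj H]
    [IsIso (HopfObj.antipode (X := H))] {X : C}
    (a : H ⊗ X ⟶ X) (mul : MonObj.mul ▷ X ≫ a = (α_ H H X).hom ≫ H ◁ a ≫ a) :
    MonObj.mul ▷ R.hom X ≫ rightDualAct R a =
      (α_ H H (R.hom X)).hom ≫ H ◁ rightDualAct R a ≫ rightDualAct R a := by
  have h := hopfNu'_mul R H X
  rw [Category.assoc, Iso.inv_comp_eq] at h
  rw [rightDualAct, ← whisker_exchange_assoc, h, associator_naturality_right_assoc]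
  simp only [← whiskerLeft_comp_assoc, Category.assoc]
  rw [← hopfNu'_naturality, ← R.map_comp, Category.assoc, mul, Iso.inv_hom_id_assoc, R.map_comp]
  simp

theorem tensorComul_tensorHom_assoc (H : C) [ComonObj H] {X Y Z X' Y' Z' : C} (x : H ⊗ X ⟶ X')
    (y : H ⊗ Y ⟶ Y') (z : H ⊗ Z ⟶ Z') :
    tensorComul H (X ⊗ Y) Z ≫ ((tensorComul H X Y ≫ (x ⊗ₘ y)) ⊗ₘ z) ≫ (α_ X' Y' Z').hom =
      H ◁ (α_ X Y Z).hom ≫ tensorComul H X (Y ⊗ Z) ≫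
        (x ⊗ₘ (tensorComul H Y Z ≫ (y ⊗ₘ z))) := by
  have h := tensorComul_assoc H X Y Z
  have h1 : (tensorComul H X Y ≫ (x ⊗ₘ y)) ⊗ₘ z =
      tensorComul H X Y ▷ (H ⊗ Z) ≫ ((x ⊗ₘ y) ⊗ₘ z) := by
    rw [← tensorHom_id, tensorHom_comp_tensorHom, Category.id_comp]
  have h2 : x ⊗ₘ (tensorComul H Y Z ≫ (y ⊗ₘ z)) =
      (H ⊗ X) ◁ tensorComul H Y Z ≫ (x ⊗ₘ (y ⊗ₘ z)) := by
    rw [← id_tensorHom, tensorHom_comp_tensorHom, Category.id_comp]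
  rw [h1, h2, ← reassoc_of% h, Category.assoc, associator_naturality]

theorem tensorAct_one (H : C) [BimonObj H] {A B : C} (a : H ⊗ A ⟶ A) (b : H ⊗ B ⟶ B)
    (a_one : MonObj.one ▷ A ≫ a = (λ_ A).hom) (b_one : MonObj.one ▷ B ≫ b = (λ_ B).hom) :
    MonObj.one ▷ (A ⊗ B) ≫ tensorComul H A B ≫ (a ⊗ₘ b) = (λ_ (A ⊗ B)).hom := by
  have h := one_tensorComul H A B
  rw [Category.assoc, Iso.inv_comp_eq] at h
  rw [reassoc_of% h, tensorHom_comp_tensorHom, Category.assoc, Category.assoc, a_one, b_one]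
  simp

theorem tensorAct_mul (H : C) [BimonObj H] {A B : C} (a : H ⊗ A ⟶ A) (b : H ⊗ B ⟶ B)
    (a_mul : MonObj.mul ▷ A ≫ a = (α_ H H A).hom ≫ H ◁ a ≫ a)
    (b_mul : MonObj.mul ▷ B ≫ b = (α_ H H B).hom ≫ H ◁ b ≫ b) :
    MonObj.mul ▷ (A ⊗ B) ≫ tensorComul H A B ≫ (a ⊗ₘ b) =
      (α_ H H (A ⊗ B)).hom ≫ H ◁ (tensorComul H A B ≫ (a ⊗ₘ b)) ≫
        tensorComul H A B ≫ (a ⊗ₘ b) := by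
  have h := mul_tensorComul H A B
  rw [Category.assoc, Iso.inv_comp_eq] at h
  have h2 := tensorComul_natural H a b
  rw [reassoc_of% h, MonoidalCategory.whiskerLeft_comp, Category.assoc, ← reassoc_of% h2,
    tensorHom_comp_tensorHom, tensorHom_comp_tensorHom, Category.assoc, Category.assoc,
    a_mul, b_mul, Iso.inv_hom_id_assoc, Iso.inv_hom_id_assoc]

/-- The evaluation of S(A ⊗ B) against A ⊗ B is invariant. Since the diagonal action is compatible
with the associator, it is also invariant as a pairing of S(A ⊗ B) ⊗ A with B, and its transpose
e_{A,B} is therefore a module map. -/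
theorem evTensor_leftDualAct {D : C} (L : LeftRaiser D) (H : C) [HopfObj H] {A B : C}
    (a : H ⊗ A ⟶ A) (b : H ⊗ B ⟶ B)
    (a_one : MonObj.one ▷ A ≫ a = (λ_ A).hom) (b_one : MonObj.one ▷ B ≫ b = (λ_ B).hom)
    (a_mul : MonObj.mul ▷ A ≫ a = (α_ H H A).hom ≫ H ◁ a ≫ a)
    (b_mul : MonObj.mul ▷ B ≫ b = (α_ H H B).hom ≫ H ◁ b ≫ b) :
    H ◁ L.evTensor A B ≫ leftDualAct L b =
      tensorComul H (L.hom (A ⊗ B)) A ≫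
        (leftDualAct L (tensorComul H A B ≫ (a ⊗ₘ b)) ⊗ₘ a) ≫ L.evTensor A B := by
  have h := leftDualAct_ev_invariant L _ (tensorAct_one H a b a_one b_one)
    (tensorAct_mul H a b a_mul b_mul)
  rw [← Category.assoc (tensorComul H (L.hom (A ⊗ B)) A), LeftRaiser.evTensor]
  symm
  apply curry_leftDualAct
  rw [← tensor_invariant_iff H _ _ b_one b_mul, MonoidalCategory.whiskerLeft_comp, Category.assoc,
    ← h]
  have h' := tensorComul_tensorHom_assoc H
    (leftDualAct L (tensorComul H A B ≫ (a ⊗ₘ b))) a b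
  rw [reassoc_of% h']

/-- Evaluated against S'(H ⊗ X), the right-hand side receives σ from ν and σ⁻¹ from ν', which
cancel. -/
theorem raiserUnit_hopf {D : C} (L : LeftRaiser D) (R : RightRaiser D) (H : C) [HopfObj H]
    [IsIso (HopfObj.antipode (X := H))] (X : C) :
    raiserUnit L R (H ⊗ X) =
      H ◁ raiserUnit L R X ≫ H ◁ L.map (hopfNu' R H X) ≫ hopfNu L H (R.hom (H ⊗ X)) := by
  have h := hopfNu_ev L H (R.hom (H ⊗ X))
  simp only [actLeft, Category.assoc] at h
  apply L.hom_ext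
  rw [comp_whiskerRight_assoc, comp_whiskerRight_assoc, ← cancel_epi (α_ _ _ _).inv,
    ← associator_inv_naturality_middle_assoc, ← associator_inv_naturality_middle_assoc, h,
    reassoc_of% crossing_naturality_middle, reassoc_of% crossing_naturality_middle,
    ← whisker_exchange_assoc,
    ← whisker_exchange_assoc, L.map_ev, ← whisker_exchange_assoc, raiserUnit, raiserUnit,
    L.curry_ev, L.curry_ev, ← reassoc_of% crossing_naturality_left, hopfNu'_ev,
    ← comp_whiskerRight_assoc, IsIso.hom_inv_id, id_whiskerRight, Category.id_comp]

theorem raiserCounit_hopf {D : C} (L : LeftRaiser D) (R : RightRaiser D) (H : C) [HopfObj H]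
    [IsIso (HopfObj.antipode (X := H))] (X : C) :
    raiserCounit L R (H ⊗ X) =
      H ◁ raiserCounit L R X ≫ H ◁ R.map (hopfNu L H X) ≫ hopfNu' R H (L.hom (H ⊗ X)) := by
  have h := hopfNu_ev L H X
  simp only [actLeft, Category.assoc] at h
  apply R.hom_ext
  rw [whiskerLeft_comp_assoc, whiskerLeft_comp_assoc, ← cancel_epi (crossing _ _ _).hom,
    ← reassoc_of% crossing_naturality_right, ← reassoc_of% crossing_naturality_right, hopfNu'_ev,
    whisker_exchange_assoc, whisker_exchange_assoc, associator_inv_naturality_right_assoc,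
    associator_inv_naturality_right_assoc, R.map_ev, whisker_exchange_assoc, raiserCounit,
    raiserCounit, R.curry_ev, R.curry_ev, h, reassoc_of% crossing_naturality_left,
    ← whiskerLeft_comp_assoc, ← comp_whiskerRight, IsIso.inv_hom_id]
  simp

/-- The dual of the trivial action is trivial, because ε ∘ σ = ε. -/
theorem leftDualAct_tensorCounit {D : C} (L : LeftRaiser D) (H : C) [HopfObj H] :
    leftDualAct L (tensorCounit H) = ComonObj.counit ▷ L.hom (𝟙_ C) ≫ (λ_ _).hom := by
  apply L.hom_ext
  have h := leftDualAct_ev L (tensorCounit H)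
  simp only [actLeft, actRight, Category.assoc] at h
  rw [← cancel_epi (α_ _ _ _).inv, h, reassoc_of% crossing_naturality_left,
    ← whiskerLeft_comp_assoc,
    tensorCounit_eq, ← comp_whiskerRight_assoc, HopfObj.antipode_counit,
    MonoidalCategory.whiskerLeft_comp, Category.assoc, ← reassoc_of% crossing_naturality_left,
    crossing_unit]
  simp only [whiskerRight_tensor, comp_whiskerRight, Category.assoc]
  monoidal

/-- Both I and SI carry trivial actions, and ε ∘ σ = ε supplies the antipode condition for the
pairing whose transpose is n_I. -/
theorem unitDual_hopf {D : C} (L : LeftRaiser D) (H : C) [HopfObj H] :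
    tensorCounit H ≫ L.unitDual =
      H ◁ L.unitDual ≫ H ◁ L.map (hopfNu L H (𝟙_ C)) ≫
        H ◁ L.map (H ◁ L.map (tensorCounit H)) ≫ hopfNu L H (L.hom (𝟙_ C)) := by
  rw [← whiskerLeft_comp_assoc H (L.map _) (L.map _), ← L.map_comp]
  have h := leftDualAct_tensorCounit L H
  rw [leftDualAct] at h
  rw [h]
  apply curry_leftDualAct
  simp only [actLeft, actRight, Category.assoc]
  rw [reassoc_of% crossing_naturality_left, ← whiskerLeft_comp_assoc, ← comp_whiskerRight_assoc,
    HopfObj.antipode_counit,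
    MonoidalCategory.whiskerLeft_comp, Category.assoc, ← reassoc_of% crossing_naturality_left,
    crossing_unit, tensorCounit_eq]
  simp

theorem isStarAutonomousMonad_hopf {D : C} (L : LeftRaiser D) (R : RightRaiser D) (H : C)
    [HopfObj H] [IsIso (HopfObj.antipode (X := H))] :
    IsStarAutonomousMonad (tensorMonad H) L R (hopfNu L H) (hopfNu' R H) where
  isOpmonoidalMonad :=
    { η_unit := one_tensorCounit H
      η_tensor := one_tensorComul H
      μ_unit := mul_tensorCounit H
      μ_tensor := mul_tensorComul H }
  naturality f := hopfNu_naturality L H f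
  naturality' f := hopfNu'_naturality R H f
  unit := hopfNu_unit L H
  unit' := hopfNu'_unit R H
  mul := hopfNu_mul L H
  mul' := hopfNu'_mul R H
  evTensor A B := by
    have one {A : C} (a : H ⊗ A ⟶ A) (h : ((λ_ A).inv ≫ MonObj.one ▷ A) ≫ a = 𝟙 A) :
        MonObj.one ▷ A ≫ a = (λ_ A).hom := by
      rwa [Category.assoc, Iso.inv_comp_eq, Category.comp_id] at h
    have mul {A : C} (a : H ⊗ A ⟶ A) (h : ((α_ H H A).inv ≫ MonObj.mul ▷ A) ≫ a = H ◁ a ≫ a) :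
        MonObj.mul ▷ A ≫ a = (α_ H H A).hom ≫ H ◁ a ≫ a := by
      rwa [Category.assoc, Iso.inv_comp_eq] at h
    exact evTensor_leftDualAct L H A.a B.a (one A.a A.unit) (one B.a B.unit) (mul A.a A.assoc)
      (mul B.a B.assoc)
  unitDual := unitDual_hopf L H
  dualUnit := raiserUnit_hopf L R H
  dualCounit := raiserCounit_hopf L R H

end Hopf

/-! ### Naturality of e_{A,B}, α and β -/

section Duals

variable {C : Type u} [Category.{v} C] [MonoidalCategory C] {D : C}

theorem LeftRaiser.evTensor_naturality (L : LeftRaiser D) {A A' B B' : C} (f : A ⟶ A')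
    (g : B ⟶ B') :
    L.hom (A' ⊗ B') ◁ f ≫ L.evTensor A' B' ≫ L.map g =
      L.map (f ⊗ₘ g) ▷ A ≫ L.evTensor A B := by
  apply L.hom_ext
  simp only [comp_whiskerRight, Category.assoc]
  rw [L.map_ev, ← whisker_exchange_assoc, L.evTensor_ev, L.evTensor_ev,
    associator_naturality_left_assoc, L.map_ev, MonoidalCategory.tensorHom_def]
  simp

theorem raiserUnit_naturality (L : LeftRaiser D) (R : RightRaiser D) {X Y : C} (f : X ⟶ Y) :
    f ≫ raiserUnit L R Y = raiserUnit L R X ≫ L.map (R.map f) := by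
  apply L.hom_ext
  rw [comp_whiskerRight_assoc, comp_whiskerRight_assoc, L.map_ev, ← whisker_exchange_assoc,
    raiserUnit, raiserUnit, L.curry_ev, L.curry_ev, R.map_ev]

theorem raiserCounit_naturality (L : LeftRaiser D) (R : RightRaiser D) {X Y : C} (f : X ⟶ Y) :
    f ≫ raiserCounit L R Y = raiserCounit L R X ≫ R.map (L.map f) := by
  apply R.hom_ext
  rw [whiskerLeft_comp_assoc, whiskerLeft_comp_assoc, R.map_ev, whisker_exchange_assoc,
    raiserCounit, raiserCounit, R.curry_ev, R.curry_ev, L.map_ev]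

end Duals

/-! ### Mates of a *-autonomous opmonoidal monad form a *-autonomous comonad -/

section Mates

variable {C : Type u} [Category.{v} C]

/-- The counit `FGX ⟶ X` of an adjunction `F ⊣ G` of endofunctors. -/
def counitApp {F G : C ⥤ C} (adj : F ⊣ G) (X : C) : F.obj (G.obj X) ⟶ X := adj.counit.app X

theorem counitApp_naturality {F G : C ⥤ C} (adj : F ⊣ G) {X Y : C} (f : X ⟶ Y) :
    F.map (G.map f) ≫ counitApp adj Y = counitApp adj X ≫ f :=
  adj.counit_naturality f

theorem map_homEquiv_counitApp {F G : C ⥤ C} (adj : F ⊣ G) {X Y : C} (f : F.obj X ⟶ Y) :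
    F.map (adj.homEquiv X Y f) ≫ counitApp adj Y = f :=
  (adj.homEquiv_counit X Y _).symm.trans (Equiv.symm_apply_apply _ f)

/-- Transposition along the adjunction, used to turn identities into GY into identities out of a
value of T. -/
theorem map_counitApp_injective {F G : C ⥤ C} (adj : F ⊣ G) {X Y : C}
    {f g : X ⟶ G.obj Y} (h : F.map f ≫ counitApp adj Y = F.map g ≫ counitApp adj Y) : f = g := by
  apply (adj.homEquiv _ _).symm.injective
  rw [adj.homEquiv_counit, adj.homEquiv_counit]
  exact h

/-- The unit `X ⟶ TX` of a monad. -/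
def unitApp (T : Monad C) (X : C) : X ⟶ T.obj X := T.η.app X

theorem unitApp_naturality (T : Monad C) {X Y : C} (f : X ⟶ Y) :
    unitApp T X ≫ T.map f = f ≫ unitApp T Y :=
  (T.η.naturality f).symm

/-- The counit of `mateComonad`. -/
def mateCounit (T : Monad C) {G : C ⥤ C} (adj : T.toFunctor ⊣ G) (X : C) : G.obj X ⟶ X :=
  unitApp T (G.obj X) ≫ counitApp adj X

theorem mateComonad_ε_app (T : Monad C) {G : C ⥤ C} (adj : T.toFunctor ⊣ G) (X : C) :
    (mateComonad T adj).ε.app X = mateCounit T adj X :=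
  show (conjugateEquiv adj Adjunction.id T.η).app X = T.η.app (G.obj X) ≫ adj.counit.app X by simp

theorem mateComonad_δ_app (T : Monad C) {G : C ⥤ C} (adj : T.toFunctor ⊣ G) (X : C) :
    (mateComonad T adj).δ.app X = mateComul T adj X :=
  show (conjugateEquiv adj (adj.comp adj) T.μ).app X = mateComul T adj X by
    simp [mateComul, mateAction]

theorem comp_mateCounit (T : Monad C) {G : C ⥤ C} (adj : T.toFunctor ⊣ G) {X Y : C}
    (f : X ⟶ G.obj Y) :
    f ≫ mateCounit T adj Y = unitApp T X ≫ T.map f ≫ counitApp adj Y := by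
  rw [mateCounit, ← Category.assoc, ← unitApp_naturality, Category.assoc]

theorem map_mateAction_counitApp (T : Monad C) {G : C ⥤ C} (adj : T.toFunctor ⊣ G) (X : C) :
    T.map (mateAction T adj X) ≫ counitApp adj X = T.μ.app (G.obj X) ≫ counitApp adj X :=
  map_mateAction T adj X

theorem map_mateComul_counitApp (T : Monad C) {G : C ⥤ C} (adj : T.toFunctor ⊣ G) (X : C) :
    T.map (mateComul T adj X) ≫ counitApp adj (G.obj X) = mateAction T adj X :=
  map_mateComul T adj X

theorem mateAction_mateCounit (T : Monad C) {G : C ⥤ C} (adj : T.toFunctor ⊣ G) (X : C) :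
    mateAction T adj X ≫ mateCounit T adj X = counitApp adj X := by
  have h : unitApp T (T.obj (G.obj X)) ≫ T.μ.app (G.obj X) = 𝟙 _ := T.left_unit (G.obj X)
  rw [comp_mateCounit, map_mateAction_counitApp, reassoc_of% h]

theorem map_mateAction_comp (T : Monad C) {G : C ⥤ C} (adj : T.toFunctor ⊣ G) {X Y : C}
    (f : X ⟶ G.obj Y) :
    T.map (T.map f ≫ mateAction T adj Y) ≫ counitApp adj Y =
      T.μ.app X ≫ T.map f ≫ counitApp adj Y := by
  rw [Functor.map_comp, Category.assoc, map_mateAction_counitApp, T.mu_naturality_assoc]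

theorem map_comp_mateComul (T : Monad C) {G : C ⥤ C} (adj : T.toFunctor ⊣ G) {X Y : C}
    (f : X ⟶ G.obj Y) :
    T.map (f ≫ mateComul T adj Y) ≫ counitApp adj (G.obj Y) = T.map f ≫ mateAction T adj Y := by
  rw [Functor.map_comp, Category.assoc, map_mateComul_counitApp]

variable [MonoidalCategory C]

open Functor.OplaxMonoidal in
/-- The tensor constraint of the right adjoint of an opmonoidal functor. -/
def mateTensor {F G : C ⥤ C} [F.OplaxMonoidal] (adj : F ⊣ G) (X Y : C) :
    G.obj X ⊗ G.obj Y ⟶ G.obj (X ⊗ Y) :=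
  adj.homEquiv _ _ (δ F _ _ ≫ (counitApp adj X ⊗ₘ counitApp adj Y))

open Functor.OplaxMonoidal in
/-- The unit constraint of the right adjoint of an opmonoidal functor. -/
def mateUnit {F G : C ⥤ C} [F.OplaxMonoidal] (adj : F ⊣ G) : 𝟙_ C ⟶ G.obj (𝟙_ C) :=
  adj.homEquiv _ _ (η F)

theorem mateComonad_μ (T : Monad C) [T.toFunctor.OplaxMonoidal] {G : C ⥤ C}
    (adj : T.toFunctor ⊣ G) (X Y : C) :
    Functor.LaxMonoidal.μ (mateComonad T adj).toFunctor X Y = mateTensor adj X Y := rfl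

theorem mateComonad_ε (T : Monad C) [T.toFunctor.OplaxMonoidal] {G : C ⥤ C}
    (adj : T.toFunctor ⊣ G) :
    Functor.LaxMonoidal.ε (mateComonad T adj).toFunctor = mateUnit adj := rfl

theorem map_mateTensor {F G : C ⥤ C} [F.OplaxMonoidal] (adj : F ⊣ G) (X Y : C) :
    F.map (mateTensor adj X Y) ≫ counitApp adj (X ⊗ Y) =
      Functor.OplaxMonoidal.δ F _ _ ≫ (counitApp adj X ⊗ₘ counitApp adj Y) := by
  exact map_homEquiv_counitApp adj _

theorem map_mateUnit {F G : C ⥤ C} [F.OplaxMonoidal] (adj : F ⊣ G) :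
    F.map (mateUnit adj) ≫ counitApp adj (𝟙_ C) = Functor.OplaxMonoidal.η F := by
  exact map_homEquiv_counitApp adj _

theorem LeftRaiser.map_mate {D : C} (L : LeftRaiser D) (T : Monad C) {G : C ⥤ C}
    (adj : T.toFunctor ⊣ G) (ν : ∀ X, T.obj (L.hom (T.obj X)) ⟶ L.hom X) (X : C) :
    T.map (L.mate T adj ν X) ≫ counitApp adj (L.hom (G.obj X)) =
      T.map (L.map (counitApp adj X)) ≫ ν (G.obj X) := by
  exact map_homEquiv_counitApp adj _

theorem RightRaiser.map_mate {D : C} (R : RightRaiser D) (T : Monad C) {G : C ⥤ C}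
    (adj : T.toFunctor ⊣ G) (ν' : ∀ X, T.obj (R.hom (T.obj X)) ⟶ R.hom X) (X : C) :
    T.map (R.mate T adj ν' X) ≫ counitApp adj (R.hom (G.obj X)) =
      T.map (R.map (counitApp adj X)) ≫ ν' (G.obj X) := by
  exact map_homEquiv_counitApp adj _

variable (T : Monad C) [T.toFunctor.OplaxMonoidal] {G : C ⥤ C} (adj : T.toFunctor ⊣ G)

theorem mateTensor_mateCounit (hT : IsOpmonoidalMonad T) (X Y : C) :
    mateTensor adj X Y ≫ mateCounit T adj (X ⊗ Y) =
      (mateCounit T adj X ⊗ₘ mateCounit T adj Y) := by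
  rw [comp_mateCounit, map_mateTensor, mateCounit, mateCounit,
    ← tensorHom_comp_tensorHom, ← Category.assoc]
  exact congrArg (· ≫ _) (hT.η_tensor _ _)

theorem mateUnit_mateCounit (hT : IsOpmonoidalMonad T) :
    mateUnit adj ≫ mateCounit T adj (𝟙_ C) = 𝟙 _ := by
  rw [comp_mateCounit, map_mateUnit]
  exact hT.η_unit

/-- The comultiplication is the transpose of the action TGX → GX, itself the transpose of a map
built from the multiplication of T. Two transpositions therefore reach the opmonoidality of that
multiplication. -/
theorem mateTensor_mateComul (hT : IsOpmonoidalMonad T) (X Y : C) :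
    mateTensor adj X Y ≫ mateComul T adj (X ⊗ Y) =
      (mateComul T adj X ⊗ₘ mateComul T adj Y) ≫ mateTensor adj (G.obj X) (G.obj Y) ≫
        G.map (mateTensor adj X Y) := by
  apply map_counitApp_injective adj
  rw [map_comp_mateComul, Functor.map_comp, Functor.map_comp, Category.assoc, Category.assoc,
    counitApp_naturality adj, reassoc_of% map_mateTensor adj]
  have h := Functor.OplaxMonoidal.δ_natural T.toFunctor (mateComul T adj X)
    (mateComul T adj Y)
  rw [← reassoc_of% h, tensorHom_comp_tensorHom_assoc, map_mateComul_counitApp,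
    map_mateComul_counitApp]
  apply map_counitApp_injective adj
  rw [map_mateAction_comp, map_mateTensor, reassoc_of% hT.μ_tensor, Functor.map_comp,
    Functor.map_comp, Category.assoc, Category.assoc, map_mateTensor,
    ← Functor.OplaxMonoidal.δ_natural_assoc, tensorHom_comp_tensorHom, tensorHom_comp_tensorHom,
    map_mateAction_counitApp, map_mateAction_counitApp]

theorem mateUnit_mateComul (hT : IsOpmonoidalMonad T) :
    mateUnit adj ≫ mateComul T adj (𝟙_ C) = mateUnit adj ≫ G.map (mateUnit adj) := by
  apply map_counitApp_injective adj
  rw [map_comp_mateComul, Functor.map_comp, Category.assoc,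
    counitApp_naturality adj, reassoc_of% map_mateUnit adj]
  apply map_counitApp_injective adj
  rw [map_mateAction_comp, map_mateUnit, hT.μ_unit, Functor.map_comp, Category.assoc, map_mateUnit]

variable {D : C} {L : LeftRaiser D} {R : RightRaiser D}
    {ν : ∀ X, T.obj (L.hom (T.obj X)) ⟶ L.hom X}
    {ν' : ∀ X, T.obj (R.hom (T.obj X)) ⟶ R.hom X}
    (h : IsStarAutonomousMonad T L R ν ν')

include h

theorem leftMate_naturality {X Y : C} (f : X ⟶ Y) :
    L.map f ≫ L.mate T adj ν X = L.mate T adj ν Y ≫ G.map (L.map (G.map f)) := by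
  apply map_counitApp_injective adj
  rw [Functor.map_comp, Functor.map_comp, Category.assoc, Category.assoc, L.map_mate,
    counitApp_naturality adj, reassoc_of% L.map_mate T adj ν Y, ← h.naturality,
    ← Functor.map_comp_assoc, ← Functor.map_comp_assoc, ← L.map_comp, ← L.map_comp,
    counitApp_naturality adj]

theorem rightMate_naturality {X Y : C} (f : X ⟶ Y) :
    R.map f ≫ R.mate T adj ν' X = R.mate T adj ν' Y ≫ G.map (R.map (G.map f)) := by
  apply map_counitApp_injective adj
  rw [Functor.map_comp, Functor.map_comp, Category.assoc, Category.assoc, R.map_mate,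
    counitApp_naturality adj, reassoc_of% R.map_mate T adj ν' Y, ← h.naturality',
    ← Functor.map_comp_assoc, ← Functor.map_comp_assoc, ← R.map_comp, ← R.map_comp,
    counitApp_naturality adj]

theorem leftMate_counit (X : C) :
    L.mate T adj ν X ≫ mateCounit T adj (L.hom (G.obj X)) = L.map (mateCounit T adj X) := by
  rw [comp_mateCounit, L.map_mate, mateCounit, L.map_comp, ← Category.assoc,
    unitApp_naturality, Category.assoc]
  exact congrArg (_ ≫ ·) (h.unit _)

theorem rightMate_counit (X : C) :
    R.mate T adj ν' X ≫ mateCounit T adj (R.hom (G.obj X)) = R.map (mateCounit T adj X) := by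
  rw [comp_mateCounit, R.map_mate, mateCounit, R.map_comp, ← Category.assoc,
    unitApp_naturality, Category.assoc]
  exact congrArg (_ ≫ ·) (h.unit' _)

theorem leftMate_comul (X : C) :
    L.mate T adj ν X ≫ mateComul T adj (L.hom (G.obj X)) =
      L.mate T adj ν X ≫ G.map (L.mate T adj ν (G.obj X)) ≫
        G.map (G.map (L.map (mateComul T adj X))) := by
  apply map_counitApp_injective adj
  rw [map_comp_mateComul, ← G.map_comp, Functor.map_comp T.toFunctor, Category.assoc,
    counitApp_naturality adj, reassoc_of% L.map_mate T adj ν X]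
  apply map_counitApp_injective adj
  rw [map_mateAction_comp, L.map_mate, ← T.mu_naturality_assoc, h.mul]
  simp only [Functor.map_comp, Category.assoc]
  rw [counitApp_naturality adj, reassoc_of% L.map_mate T adj ν (G.obj X), ← h.naturality]
  rw [← Functor.map_comp_assoc T.toFunctor (L.map _) (L.map _), ← L.map_comp,
    map_mateComul_counitApp,
    ← Functor.map_comp_assoc T.toFunctor (ν _) (L.map _), ← h.naturality]
  -- What remains compares T of the action with the multiplication of T: both have the same
  -- composite with the counit of T ⊣ G, and S reverses that equation.
  have key : L.map (counitApp adj X) ≫ L.map (T.map (mateAction T adj X)) =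
      L.map (counitApp adj X) ≫ L.map (T.μ.app (G.obj X)) := by
    rw [← L.map_comp, ← L.map_comp, map_mateAction_counitApp]
  have key' := congrArg (fun k => T.map (T.map k)) key
  simp only [Functor.map_comp] at key'
  rw [Functor.map_comp T.toFunctor (T.map _) (ν _), Category.assoc, reassoc_of% key']

theorem rightMate_comul (X : C) :
    R.mate T adj ν' X ≫ mateComul T adj (R.hom (G.obj X)) =
      R.mate T adj ν' X ≫ G.map (R.mate T adj ν' (G.obj X)) ≫
        G.map (G.map (R.map (mateComul T adj X))) := by
  apply map_counitApp_injective adj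
  rw [map_comp_mateComul, ← G.map_comp, Functor.map_comp T.toFunctor, Category.assoc,
    counitApp_naturality adj, reassoc_of% R.map_mate T adj ν' X]
  apply map_counitApp_injective adj
  rw [map_mateAction_comp, R.map_mate, ← T.mu_naturality_assoc, h.mul']
  simp only [Functor.map_comp, Category.assoc]
  rw [counitApp_naturality adj, reassoc_of% R.map_mate T adj ν' (G.obj X), ← h.naturality']
  rw [← Functor.map_comp_assoc T.toFunctor (R.map _) (R.map _), ← R.map_comp,
    map_mateComul_counitApp,
    ← Functor.map_comp_assoc T.toFunctor (ν' _) (R.map _), ← h.naturality']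
  have key : R.map (counitApp adj X) ≫ R.map (T.map (mateAction T adj X)) =
      R.map (counitApp adj X) ≫ R.map (T.μ.app (G.obj X)) := by
    rw [← R.map_comp, ← R.map_comp, map_mateAction_counitApp]
  have key' := congrArg (fun k => T.map (T.map k)) key
  simp only [Functor.map_comp] at key'
  rw [Functor.map_comp T.toFunctor (T.map _) (ν' _), Category.assoc, reassoc_of% key']

theorem leftMate_evTensor (A B : C) :
    L.hom (A ⊗ B) ◁ mateCounit T adj A ≫ L.evTensor A B ≫ L.mate T adj ν B =
      (L.mate T adj ν (A ⊗ B) ⊗ₘ mateComul T adj A) ≫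
        mateTensor adj (L.hom (G.obj (A ⊗ B))) (G.obj A) ≫
          G.map (L.map (mateTensor adj A B) ▷ G.obj A) ≫
            G.map (L.evTensor (G.obj A) (G.obj B)) := by
  -- The monad axiom speaks of algebras, so it is applied to GA and GB with the actions whose
  -- transposes are the comultiplications.
  let alg (X : C) : T.Algebra :=
    { A := G.obj X
      a := mateAction T adj X
      unit := eta_mateAction T adj X
      assoc := mu_mateAction T adj X }
  have h1 := h.evTensor (alg A) (alg B)
  change T.map (L.evTensor (G.obj A) (G.obj B)) ≫ T.map (L.map (mateAction T adj B)) ≫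
    ν (G.obj B) = Functor.OplaxMonoidal.δ T.toFunctor (L.hom (G.obj A ⊗ G.obj B)) (G.obj A) ≫
      ((T.map (L.map (Functor.OplaxMonoidal.δ T.toFunctor (G.obj A) (G.obj B) ≫
        (mateAction T adj A ⊗ₘ mateAction T adj B))) ≫ ν (G.obj A ⊗ G.obj B)) ⊗ₘ
          mateAction T adj A) ≫ L.evTensor (G.obj A) (G.obj B) at h1
  apply map_counitApp_injective adj
  -- Naturality of e_{A,B} gathers the comonad counits into one tensor. The counit of T ⊣ G at B
  -- factors as the action followed by the comonad counit, which exposes the left side of the monad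
  -- axiom.
  have h2 : T.map (L.hom (A ⊗ B) ◁ mateCounit T adj A ≫ L.evTensor A B ≫ L.mate T adj ν B) ≫
      counitApp adj _ = T.map (L.map (mateCounit T adj A ⊗ₘ mateCounit T adj B) ▷ G.obj A) ≫
        T.map (L.evTensor (G.obj A) (G.obj B)) ≫ T.map (L.map (mateAction T adj B)) ≫
    ν (G.obj B) := by
    simp only [Functor.map_comp, Category.assoc]
    rw [L.map_mate, ← mateAction_mateCounit, L.map_comp]
    have h3 := congrArg (T.map ·) (L.evTensor_naturality (mateCounit T adj A) (mateCounit T adj B))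
    simp only [Functor.map_comp, Category.assoc] at h3 ⊢
    rw [reassoc_of% h3]
  rw [h2, h1, ← Functor.map_comp G]
  simp only [Functor.map_comp T.toFunctor, Category.assoc]
  rw [counitApp_naturality adj, reassoc_of% map_mateTensor adj,
    ← Functor.OplaxMonoidal.δ_natural_assoc, ← Functor.OplaxMonoidal.δ_natural_left_assoc]
  rw [← tensorHom_id, ← tensorHom_id]
  simp only [tensorHom_comp_tensorHom_assoc, Category.id_comp, Category.comp_id]
  rw [map_mateComul_counitApp, reassoc_of% L.map_mate T adj ν (A ⊗ B), ← h.naturality]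
  simp only [← Functor.map_comp_assoc, ← L.map_comp, Category.assoc, tensorHom_comp_tensorHom,
    mateAction_mateCounit, map_mateTensor]

theorem leftMate_unitDual :
    mateUnit adj ≫ G.map L.unitDual =
      L.unitDual ≫ L.mate T adj ν (L.hom (𝟙_ C)) ≫
        G.map (L.map (G.map (L.map (mateUnit adj)))) ≫
          G.map (L.map (L.mate T adj ν (𝟙_ C))) := by
  apply map_counitApp_injective adj
  rw [← G.map_comp, ← L.map_comp]
  simp only [Functor.map_comp T.toFunctor, Category.assoc]
  rw [counitApp_naturality adj, counitApp_naturality adj, reassoc_of% map_mateUnit adj,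
    reassoc_of% L.map_mate T adj ν, ← h.naturality, h.unitDual]
  simp only [← Functor.map_comp_assoc, ← L.map_comp]
  rw [Functor.map_comp T.toFunctor (L.mate T adj ν (𝟙_ C)), Category.assoc,
    counitApp_naturality adj,
    reassoc_of% L.map_mate T adj ν, ← h.naturality, ← Functor.map_comp_assoc, ← L.map_comp,
    map_mateUnit]

theorem leftMate_unit (X : C) :
    G.map (raiserUnit L R X) =
      raiserUnit L R (G.obj X) ≫ L.mate T adj ν (R.hom (G.obj X)) ≫
        G.map (L.map (R.mate T adj ν' X)) := by
  apply map_counitApp_injective adj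
  simp only [Functor.map_comp T.toFunctor, Category.assoc]
  rw [counitApp_naturality adj, counitApp_naturality adj, reassoc_of% L.map_mate T adj ν,
    ← h.naturality,
    raiserUnit_naturality, h.dualUnit, Category.assoc, Category.assoc, ← h.naturality]
  simp only [← Functor.map_comp_assoc, ← L.map_comp, R.map_mate]

theorem rightMate_counitDual (X : C) :
    G.map (raiserCounit L R X) =
      raiserCounit L R (G.obj X) ≫ R.mate T adj ν' (L.hom (G.obj X)) ≫
        G.map (R.map (L.mate T adj ν X)) := by
  apply map_counitApp_injective adj
  simp only [Functor.map_comp T.toFunctor, Category.assoc]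
  rw [counitApp_naturality adj, counitApp_naturality adj, reassoc_of% R.map_mate T adj ν',
    ← h.naturality', raiserCounit_naturality, h.dualCounit, Category.assoc, Category.assoc,
    ← h.naturality']
  simp only [← Functor.map_comp_assoc, ← R.map_comp, L.map_mate]

theorem isStarAutonomousComonad_mateComonad :
    IsStarAutonomousComonad (mateComonad T adj) L R (L.mate T adj ν) (R.mate T adj ν') where
  monoidal_ε :=
    { unit := by
        rw [mateComonad_ε_app, mateComonad_ε]
        exact mateUnit_mateCounit T adj h.isOpmonoidalMonad
      tensor X Y := by
        rw [mateComonad_ε_app, mateComonad_ε_app, mateComonad_ε_app, mateComonad_μ]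
        exact (mateTensor_mateCounit T adj h.isOpmonoidalMonad X Y).trans
          (Category.comp_id _).symm }
  monoidal_δ :=
    { unit := by
        rw [mateComonad_δ_app, mateComonad_ε]
        exact mateUnit_mateComul T adj h.isOpmonoidalMonad
      tensor X Y := by
        rw [mateComonad_δ_app, mateComonad_δ_app, mateComonad_δ_app, mateComonad_μ]
        exact mateTensor_mateComul T adj h.isOpmonoidalMonad X Y }
  naturality f := leftMate_naturality T adj h f
  naturality' f := rightMate_naturality T adj h f
  counit X := by
    rw [mateComonad_ε_app, mateComonad_ε_app]
    exact leftMate_counit T adj h X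
  counit' X := by
    rw [mateComonad_ε_app, mateComonad_ε_app]
    exact rightMate_counit T adj h X
  comul X := by
    rw [mateComonad_δ_app, mateComonad_δ_app]
    exact leftMate_comul T adj h X
  comul' X := by
    rw [mateComonad_δ_app, mateComonad_δ_app]
    exact rightMate_comul T adj h X
  evTensor A B := by
    rw [mateComonad_ε_app, mateComonad_δ_app]
    exact leftMate_evTensor T adj h A B
  unitDual := leftMate_unitDual T adj h
  unit X := leftMate_unit T adj h X
  counitDual X := rightMate_counitDual T adj h X

end Mates

/-! ### S is an equivalence when α and β are invertible, and conversely -/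

section Equivalence

variable {C : Type u} [Category.{v} C] [MonoidalCategory C] {D : C} (L : LeftRaiser D)
    (R : RightRaiser D)

theorem raiserUnit_map_raiserCounit (B : C) :
    raiserUnit L R (L.hom B) ≫ L.map (raiserCounit L R B) = 𝟙 _ := by
  apply L.hom_ext
  rw [comp_whiskerRight_assoc, L.map_ev, ← whisker_exchange_assoc, raiserUnit, L.curry_ev,
    raiserCounit, R.curry_ev, id_whiskerRight, Category.id_comp]

/-- Composition with `β_B` is, up to the adjunction bijections, the action of `S` on morphisms. -/
theorem homEquiv_comp_raiserCounit {X B : C} (f : X ⟶ B) :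
    R.homEquiv (L.hom B) X (f ≫ raiserCounit L R B) = L.homEquiv (L.hom B) X (L.map f) := by
  rw [R.homEquiv_eq, L.homEquiv_eq, L.map_ev, MonoidalCategory.whiskerLeft_comp, Category.assoc,
    raiserCounit, R.curry_ev]

/-- Full faithfulness of S makes composition with β_B bijective on maps from every X; Yoneda
concludes. -/
theorem isIso_raiserCounit [L.dual.IsEquivalence] (B : C) : IsIso (raiserCounit L R B) := by
  apply isIso_of_yoneda_map_bijective
  intro X
  have h : (fun f : X ⟶ B => f ≫ raiserCounit L R B) =
      (R.homEquiv (L.hom B) X).symm ∘ L.homEquiv (L.hom B) X ∘ (fun f => L.map f) := by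
    funext f
    simp [← homEquiv_comp_raiserCounit L R]
  rw [h]
  refine (Equiv.bijective _).comp ((Equiv.bijective _).comp ?_)
  constructor
  · intro f g hfg
    exact Quiver.Hom.op_inj (L.dual.map_injective hfg)
  · intro k
    obtain ⟨f, hf⟩ := L.dual.map_surjective (X := op B) (Y := op X) k
    exact ⟨f.unop, hf⟩

theorem isIso_leftRaiser_map {X Y : C} (f : X ⟶ Y) [IsIso f] : IsIso (L.map f) :=
  ⟨L.map (inv f), by rw [← L.map_comp, IsIso.inv_hom_id, L.map_id],
    by rw [← L.map_comp, IsIso.hom_inv_id, L.map_id]⟩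

theorem isIso_rightRaiser_map {X Y : C} (f : X ⟶ Y) [IsIso f] : IsIso (R.map f) :=
  ⟨R.map (inv f), by rw [← R.map_comp, IsIso.inv_hom_id, R.map_id],
    by rw [← R.map_comp, IsIso.hom_inv_id, R.map_id]⟩

/-- On an object SB the triangle identity exhibits α as the inverse of Sβ_B. Every A is isomorphic
to some SB, and naturality of α transfers the result. -/
theorem isIso_raiserUnit [L.dual.IsEquivalence] (A : C) : IsIso (raiserUnit L R A) := by
  let B := (L.dual.objPreimage A).unop
  let i : A ⟶ L.hom B := (L.dual.objObjPreimageIso A).inv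
  have hi : IsIso i := inferInstanceAs (IsIso (L.dual.objObjPreimageIso A).inv)
  have := isIso_raiserCounit L R B
  have := isIso_leftRaiser_map L (raiserCounit L R B)
  have hB : IsIso (raiserUnit L R (L.hom B)) := by
    have h := raiserUnit_map_raiserCounit L R B
    rw [← IsIso.eq_comp_inv] at h
    rw [h]
    infer_instance
  have := isIso_rightRaiser_map R i
  have := isIso_leftRaiser_map L (R.map i)
  have h := raiserUnit_naturality L R i
  rw [← IsIso.comp_inv_eq] at h
  rw [← h]
  infer_instance

theorem dual_isEquivalence (hα : ∀ A, IsIso (raiserUnit L R A))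
    (hβ : ∀ B, IsIso (raiserCounit L R B)) : L.dual.IsEquivalence where
  faithful := ⟨fun {X Y f g} h => by
    have h' : L.map f.unop = L.map g.unop := h
    have h1 : f.unop ≫ raiserCounit L R X.unop = g.unop ≫ raiserCounit L R X.unop := by
      rw [raiserCounit_naturality, raiserCounit_naturality, h']
    exact Quiver.Hom.unop_inj ((cancel_mono _).1 h1)⟩
  full := ⟨fun {X Y} k => by
    change L.hom X.unop ⟶ L.hom Y.unop at k
    -- Naturality of β forces this choice: a preimage f of k satisfies f ≫ β = β ≫ S'k.
    let f : Y.unop ⟶ X.unop :=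
      raiserCounit L R Y.unop ≫ R.map k ≫ inv (raiserCounit L R X.unop)
    have h1 : R.map (L.map f) = R.map k := by
      rw [← cancel_epi (raiserCounit L R Y.unop), ← raiserCounit_naturality]
      simp [f]
    -- Invertibility of α makes S' faithful.
    have h2 : L.map f = k := by
      rw [← cancel_mono (raiserUnit L R (L.hom Y.unop)), raiserUnit_naturality,
        raiserUnit_naturality, h1]
    exact ⟨f.op, h2⟩⟩
  essSurj := ⟨fun A => ⟨op (R.hom A), ⟨(asIso (raiserUnit L R A)).symm⟩⟩⟩

end Equivalence

/-! ### Modules as objects with an action -/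

section Actions

variable {C : Type u} [Category.{v} C] [MonoidalCategory C]

/-- The `H`-module given by an action. -/
def moduleOfAction {H : C} [MonObj H] {X : C} (a : H ⊗ X ⟶ X)
    (one : MonObj.one ▷ X ≫ a = (λ_ X).hom)
    (mul : MonObj.mul ▷ X ≫ a = (α_ H H X).hom ≫ H ◁ a ≫ a) : Mod C H :=
  letI : ModObj H X := { smul := a, one_smul := one, mul_smul := mul }
  { X := X }

theorem moduleAction_one {H : C} [MonObj H] (A : Mod C H) :
    MonObj.one ▷ A.X ≫ moduleAction A = (λ_ A.X).hom :=
  ModObj.one_smul (M := H) A.X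

theorem moduleAction_mul {H : C} [MonObj H] (A : Mod C H) :
    MonObj.mul ▷ A.X ≫ moduleAction A =
      (α_ H H A.X).hom ≫ H ◁ moduleAction A ≫ moduleAction A :=
  ModObj.mul_smul (M := H) A.X

theorem isIso_of_isIso_hom {H : C} [MonObj H] {A B : Mod C H} (f : A ⟶ B) [IsIso f.hom] :
    IsIso f := by
  have h : f = (moduleIso (asIso f.hom) (moduleAction_hom f)).hom := Mod.hom_ext _ _ rfl
  rw [h]
  infer_instance

end Actions

/-! ### The right adjoint of H ⊗ -, and duals of modules -/

section Modules

variable {C : Type u} [Category.{v} C] [MonoidalCategory C] [BraidedCategory C]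

/-- Tensoring with `H` has a right adjoint in a braided `*`-autonomous category. -/
theorem isLeftAdjoint_tensorLeft (M : StarAutonomous C) (H : C) :
    (tensorLeft H).IsLeftAdjoint := by
  have := M.isEquivalence
  have hα := isIso_raiserUnit M.left M.right
  let c (X Y : C) : (H ⊗ X) ⊗ Y ≅ X ⊗ (H ⊗ Y) := α_ H X Y ≪≫ crossing H X Y
  -- Maps H ⊗ X → Y ≅ SS'Y are pairings of H ⊗ X with S'Y. The braiding rearranges them into
  -- pairings of X with H ⊗ S'Y, that is, maps X → S(H ⊗ S'Y).
  let e (X Y : C) : (H ⊗ X ⟶ Y) ≃ (X ⟶ M.left.hom (H ⊗ M.right.hom Y)) :=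
    (asIso (raiserUnit M.left M.right Y)).homToEquiv.trans
      ((M.left.homEquiv _ _).trans
        ((c X (M.right.hom Y)).homFromEquiv.trans (M.left.homEquiv _ _).symm))
  have he (X Y : C) (k : H ⊗ X ⟶ Y) : M.left.homEquiv _ _ (e X Y k) =
      (c X (M.right.hom Y)).inv ≫
        M.left.homEquiv _ _ (k ≫ raiserUnit M.left M.right Y) :=
    Equiv.apply_symm_apply _ _
  have hc {X X' : C} (f : X' ⟶ X) (Y : C) :
      (c X' Y).inv ≫ (H ◁ f) ▷ Y = f ▷ (H ⊗ Y) ≫ (c X Y).inv := by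
    rw [Iso.inv_comp_eq, ← Category.assoc, Iso.eq_comp_inv]
    simp only [c, Iso.trans_hom, Category.assoc]
    rw [associator_naturality_middle_assoc, crossing_naturality_middle]
  refine (Adjunction.adjunctionOfEquivRight (F := tensorLeft H) e ?_).isLeftAdjoint
  intro X' X Y f g
  apply (M.left.homEquiv _ _).injective
  change M.left.homEquiv _ _ (e X' Y (H ◁ f ≫ g)) = _
  rw [M.left.homEquiv_naturality, he, he, Category.assoc, M.left.homEquiv_naturality,
    reassoc_of% hc]

/-- The object `D` with the action of `H` through its counit. -/
def trivialModule (H : C) [BimonObj H] (D : C) : Mod C H :=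
  moduleOfAction (ComonObj.counit ▷ D ≫ (λ_ D).hom)
    (by rw [← comp_whiskerRight_assoc, BimonObj.one_counit, id_whiskerRight, Category.id_comp])
    (by
      rw [← comp_whiskerRight_assoc, Bimon.mul_counit, MonoidalCategory.tensorHom_def]
      simp only [comp_whiskerRight, MonoidalCategory.whiskerLeft_comp, Category.assoc]
      rw [whisker_exchange_assoc, whisker_exchange_assoc, ← associator_naturality_left_assoc]
      simp)

/-- The morphism of modules given by an invariant morphism out of a tensor product. -/
def tensorModuleDesc {H : C} [BimonObj H] {A B : Mod C H} {D : C} (f : A.X ⊗ B.X ⟶ D)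
    (h : tensorComul H A.X B.X ≫ (moduleAction A ⊗ₘ moduleAction B) ≫ f =
      H ◁ f ≫ ComonObj.counit ▷ D ≫ (λ_ D).hom) :
    A ⊗ B ⟶ trivialModule H D :=
  Mod.Hom.mk' f (by
    change (tensorComul H A.X B.X ≫ (moduleAction A ⊗ₘ moduleAction B)) ≫ f = _
    rw [Category.assoc]
    exact h)

theorem tensorModule_hom_invariant {H : C} [BimonObj H] {A B : Mod C H} {D : C}
    (f : A ⊗ B ⟶ trivialModule H D) :
    tensorComul H A.X B.X ≫ (moduleAction A ⊗ₘ moduleAction B) ≫ f.hom =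
      H ◁ f.hom ≫ ComonObj.counit ▷ D ≫ (λ_ D).hom := by
  have h : (tensorComul H A.X B.X ≫ (moduleAction A ⊗ₘ moduleAction B)) ≫ f.hom =
      H ◁ f.hom ≫ ComonObj.counit ▷ D ≫ (λ_ D).hom := moduleAction_hom f
  exact (Category.assoc _ _ _).symm.trans h

variable {D : C} (L : LeftRaiser D) (R : RightRaiser D) {H : C} [HopfObj H]

/-- The left dual of a module. -/
def leftDualModule (A : Mod C H) : Mod C H :=
  moduleOfAction (leftDualAct L (moduleAction A)) (leftDualAct_one L _ (moduleAction_one A))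
    (leftDualAct_mul L _ (moduleAction_mul A))

theorem tensorComul_tensorHom_whiskerRight {H : C} [ComonObj H] {A A' B D : C} (a : H ⊗ A ⟶ A)
    (a' : H ⊗ A' ⟶ A') (b : H ⊗ B ⟶ B) (f : A ⟶ A') (hf : a ≫ f = H ◁ f ≫ a') (e : A' ⊗ B ⟶ D) :
    tensorComul H A B ≫ (a ⊗ₘ b) ≫ f ▷ B ≫ e =
      H ◁ f ▷ B ≫ tensorComul H A' B ≫ (a' ⊗ₘ b) ≫ e := by
  have h := tensorComul_natural H f (𝟙 B)
  rw [tensorHom_id] at h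
  rw [← reassoc_of% h, ← tensorHom_id, tensorHom_comp_tensorHom_assoc,
    tensorHom_comp_tensorHom_assoc, hf]
  simp

theorem tensorComul_tensorHom_whiskerLeft {H : C} [ComonObj H] {A B B' D : C} (a : H ⊗ A ⟶ A)
    (b : H ⊗ B ⟶ B) (b' : H ⊗ B' ⟶ B') (f : B ⟶ B') (hf : b ≫ f = H ◁ f ≫ b') (e : A ⊗ B' ⟶ D) :
    tensorComul H A B ≫ (a ⊗ₘ b) ≫ A ◁ f ≫ e =
      H ◁ A ◁ f ≫ tensorComul H A B' ≫ (a ⊗ₘ b') ≫ e := by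
  have h := tensorComul_natural H (𝟙 A) f
  rw [id_tensorHom] at h
  rw [← reassoc_of% h, ← id_tensorHom, tensorHom_comp_tensorHom_assoc,
    tensorHom_comp_tensorHom_assoc, hf]
  simp

theorem leftDualAct_hom_invariant {A B : C} (a : H ⊗ A ⟶ A) (b : H ⊗ B ⟶ B)
    (one : MonObj.one ▷ B ≫ b = (λ_ B).hom)
    (mul : MonObj.mul ▷ B ≫ b = (α_ H H B).hom ≫ H ◁ b ≫ b) (f : A ⟶ L.hom B)
    (hf : a ≫ f = H ◁ f ≫ leftDualAct L b) :
    tensorComul H A B ≫ (a ⊗ₘ b) ≫ f ▷ B ≫ L.ev B =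
      H ◁ (f ▷ B ≫ L.ev B) ≫ ComonObj.counit ▷ D ≫ (λ_ D).hom := by
  rw [tensorComul_tensorHom_whiskerRight a _ b f hf, leftDualAct_ev_invariant L _ one mul,
    whiskerLeft_comp_assoc]

theorem rightDualAct_hom_invariant [IsIso (HopfObj.antipode (X := H))] {A B : C}
    (a : H ⊗ A ⟶ A) (b : H ⊗ B ⟶ B) (one : MonObj.one ▷ A ≫ a = (λ_ A).hom)
    (mul : MonObj.mul ▷ A ≫ a = (α_ H H A).hom ≫ H ◁ a ≫ a) (f : B ⟶ R.hom A)
    (hf : b ≫ f = H ◁ f ≫ rightDualAct R a) :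
    tensorComul H A B ≫ (a ⊗ₘ b) ≫ A ◁ f ≫ R.ev A =
      H ◁ (A ◁ f ≫ R.ev A) ≫ ComonObj.counit ▷ D ≫ (λ_ D).hom := by
  rw [tensorComul_tensorHom_whiskerLeft a b _ f hf,
    rightDualAct_ev_invariant R _ (rightDualAct_one R _ one) (rightDualAct_mul R _ mul),
    whiskerLeft_comp_assoc]

theorem tensor_invariant_iff_module {A B : Mod C H} {D : C} (f : A.X ⊗ B.X ⟶ D) :
    tensorComul H A.X B.X ≫ (moduleAction A ⊗ₘ moduleAction B) ≫ f =
        H ◁ f ≫ ComonObj.counit ▷ D ≫ (λ_ D).hom ↔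
      actLeft (moduleAction A) B.X ≫ f =
        HopfObj.antipode ▷ (A.X ⊗ B.X) ≫ actRight A.X (moduleAction B) ≫ f :=
  tensor_invariant_iff H _ _ (moduleAction_one B) (moduleAction_mul B) f

/-- The left internal homs into the trivial module `D`. -/
def moduleLeftRaiser (H : C) [HopfObj H] : LeftRaiser (trivialModule H D) where
  hom := leftDualModule L
  homEquiv A B :=
    -- The bijection of the base category restricts: a module map has an invariant transpose because
    -- the evaluation is invariant, and an invariant pairing curries to a module map.
    { toFun := fun f => tensorModuleDesc (f.hom ▷ B.X ≫ L.ev B.X)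
        (leftDualAct_hom_invariant L _ _ (moduleAction_one B) (moduleAction_mul B) f.hom
          (moduleAction_hom f))
      invFun := fun g => Mod.Hom.mk' (L.curry g.hom)
        (curry_leftDualAct L (moduleAction A) (moduleAction B) g.hom
          ((tensor_invariant_iff_module g.hom).1 (tensorModule_hom_invariant g)))
      left_inv := fun f => Mod.hom_ext _ _ (L.hom_ext (L.curry_ev _))
      right_inv := fun g => Mod.hom_ext _ _ (L.curry_ev g.hom) }
  homEquiv_naturality g B f := Mod.hom_ext _ _ (by
    change (g.hom ≫ f.hom) ▷ B.X ≫ L.ev B.X = (g.hom ⊗ₘ 𝟙 B.X) ≫ f.hom ▷ B.X ≫ L.ev B.X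
    rw [tensorHom_id]
    exact comp_whiskerRight_assoc _ _ _ _)

theorem moduleLeftRaiser_ev_hom (A : Mod C H) :
    ((moduleLeftRaiser L H).ev A).hom = L.ev A.X := by
  change 𝟙 (L.hom A.X) ▷ A.X ≫ L.ev A.X = _
  simp

variable [IsIso (HopfObj.antipode (X := H))]

/-- The right dual of a module. -/
def rightDualModule (A : Mod C H) : Mod C H :=
  moduleOfAction (rightDualAct R (moduleAction A)) (rightDualAct_one R _ (moduleAction_one A))
    (rightDualAct_mul R _ (moduleAction_mul A))

/-- The right internal homs into the trivial module `D`. -/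
def moduleRightRaiser (H : C) [HopfObj H] [IsIso (HopfObj.antipode (X := H))] :
    RightRaiser (trivialModule H D) where
  hom := rightDualModule R
  homEquiv A B :=
    { toFun := fun f => tensorModuleDesc (A.X ◁ f.hom ≫ R.ev A.X)
        (rightDualAct_hom_invariant R _ _ (moduleAction_one A) (moduleAction_mul A) f.hom
          (moduleAction_hom f))
      invFun := fun g => Mod.Hom.mk' (R.curry g.hom)
        (curry_rightDualAct R (moduleAction A) (moduleAction B) g.hom
          ((tensor_invariant_iff_module g.hom).1 (tensorModule_hom_invariant g)))
      left_inv := fun f => Mod.hom_ext _ _ (R.hom_ext (R.curry_ev _))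
      right_inv := fun g => Mod.hom_ext _ _ (R.curry_ev g.hom) }
  homEquiv_naturality A _ _ g f := Mod.hom_ext _ _ (by
    change A.X ◁ (g.hom ≫ f.hom) ≫ R.ev A.X = (𝟙 A.X ⊗ₘ g.hom) ≫ A.X ◁ f.hom ≫ R.ev A.X
    rw [id_tensorHom]
    exact whiskerLeft_comp_assoc _ _ _ _)

theorem moduleRightRaiser_ev_hom (A : Mod C H) :
    ((moduleRightRaiser R H).ev A).hom = R.ev A.X := by
  change A.X ◁ 𝟙 (R.hom A.X) ≫ R.ev A.X = _
  simp

theorem module_raiserUnit_hom (A : Mod C H) :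
    (raiserUnit (moduleLeftRaiser L H) (moduleRightRaiser R H) A).hom = raiserUnit L R A.X := by
  change L.curry ((moduleRightRaiser R H).ev A).hom = _
  rw [moduleRightRaiser_ev_hom]
  rfl

theorem module_raiserCounit_hom (A : Mod C H) :
    (raiserCounit (moduleLeftRaiser L H) (moduleRightRaiser R H) A).hom =
      raiserCounit L R A.X := by
  change R.curry ((moduleLeftRaiser L H).ev A).hom = _
  rw [moduleLeftRaiser_ev_hom]
  rfl

/-- The `*`-autonomous structure on the modules over a Hopf algebra with invertible antipode. -/
def moduleStarAutonomous (M : StarAutonomous C) (H : C) [HopfObj H]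
    [IsIso (HopfObj.antipode (X := H))] : StarAutonomous (Mod C H) where
  D := trivialModule H M.D
  left := moduleLeftRaiser M.left H
  right := moduleRightRaiser M.right H
  isEquivalence := by
    have := M.isEquivalence
    -- The underlying morphisms of α and β for modules are those of the base category, and a module
    -- map with invertible underlying morphism is invertible.
    refine dual_isEquivalence _ (moduleRightRaiser M.right H) (fun A => ?_) (fun A => ?_)
    · have : IsIso
          (raiserUnit (moduleLeftRaiser M.left H) (moduleRightRaiser M.right H) A).hom := by
        rw [module_raiserUnit_hom]
        exact isIso_raiserUnit M.left M.right A.X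
      exact isIso_of_isIso_hom _
    · have : IsIso
          (raiserCounit (moduleLeftRaiser M.left H) (moduleRightRaiser M.right H) A).hom := by
        rw [module_raiserCounit_hom]
        exact isIso_raiserCounit M.left M.right A.X
      exact isIso_of_isIso_hom _

theorem moduleStarAutonomous_lifts (M : StarAutonomous C) (H : C) [HopfObj H]
    [IsIso (HopfObj.antipode (X := H))] :
    LiftsStarAutonomous (moduleStarAutonomous M H) M (hopfNu M.left H) (hopfNu' M.right H) := by
  refine ⟨Iso.refl _, fun A => ⟨Iso.refl _, ?_, ?_⟩, fun A => ⟨Iso.refl _, ?_, ?_⟩⟩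
  · change leftDualAct M.left (moduleAction A) ≫ 𝟙 _ =
      H ◁ 𝟙 _ ≫ leftDualAct M.left (moduleAction A)
    simp
  · change ((moduleLeftRaiser M.left H).ev A).hom ≫ 𝟙 _ = 𝟙 (M.left.hom A.X) ▷ A.X ≫ _
    rw [moduleLeftRaiser_ev_hom, id_whiskerRight]
    exact (Category.comp_id _).trans (Category.id_comp _).symm
  · change rightDualAct M.right (moduleAction A) ≫ 𝟙 _ =
      H ◁ 𝟙 _ ≫ rightDualAct M.right (moduleAction A)
    simp
  · change ((moduleRightRaiser M.right H).ev A).hom ≫ 𝟙 _ = A.X ◁ 𝟙 (M.right.hom A.X) ≫ _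
    rw [moduleRightRaiser_ev_hom, MonoidalCategory.whiskerLeft_id]
    exact (Category.comp_id _).trans (Category.id_comp _).symm

end Modules

end

theorem mainTheorem5 {C : Type u} [Category.{v} C] [MonoidalCategory C] [BraidedCategory C]
    (M : StarAutonomous C) (H : C) [HopfObj H] [IsIso (HopfObj.antipode (X := H))] :
    IsStarAutonomousMonad (tensorMonad H) M.left M.right (hopfNu M.left H) (hopfNu' M.right H) ∧
    (tensorMonad H).toFunctor.IsLeftAdjoint ∧
    (∀ (G : C ⥤ C) (adj : (tensorMonad H).toFunctor ⊣ G),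
      IsStarAutonomousComonad (mateComonad (tensorMonad H) adj) M.left M.right
        (M.left.mate (tensorMonad H) adj (hopfNu M.left H))
        (M.right.mate (tensorMonad H) adj (hopfNu' M.right H))) ∧
    ∃ N : StarAutonomous (Mod C H),
      LiftsStarAutonomous N M (hopfNu M.left H) (hopfNu' M.right H) :=
  ⟨isStarAutonomousMonad_hopf M.left M.right H, isLeftAdjoint_tensorLeft M H,
    fun _ adj => isStarAutonomousComonad_mateComonad _ adj
      (isStarAutonomousMonad_hopf M.left M.right H),
    moduleStarAutonomous M H, moduleStarAutonomous_lifts M H⟩
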